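/- Let $m,n$ be positive integers and $k=\gcd(m,n)$. Let $BS(m,n)=\langle a,t\mid ta^mt^{-1}=a^n\rangle$, and put $t_i=a^{-in/k}\,t\,a^{im/k}$ for $i\in\mathbb Z/k$ (well defined, since $a^{-n}ta^m=t$). Let $X_{m,n}$ be the universal cover of the presentation $2$-complex of $$\langle a,t_0,\dots,t_{k-1}\mid t_i\,a^{m/k}\,t_{i+1}^{-1}\,a^{-n/k}\ (i\in\mathbb Z/k)\rangle\cong BS(m,n),$$ that is, the Cayley $2$-complex of this presentation: its vertices are the elements $g\in BS(m,n)$, its $1$-cells are horizontal edges from $g$ to $ga$ and vertical edges from $g$ to $gt_i$, and its $2$-cells are rectangles with lower left corner $g$, left side $t_i$, top side $a^{m/k}$, right side $t_{i+1}$ and bottom side $a^{n/k}$. Let $T_{m,n}$ be the Bass–Serre tree of $BS(m,n)$, with vertices $g\langle a\rangle$ and edges $g\langle a^n\rangle$ going from $g\langle a\rangle$ to $gt\langle a\rangle$ (so every vertex has $m$ incoming and $n$ outgoing edges), regarded as a $1$-dimensional CW complex. Let $\pi\colon X_{m,n}\to T_{m,n}$ be the projection collapsing the horizontal direction. For a CW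 complex $X$, let $\operatorname{Aut}(X)$ be the group of homeomorphisms of $X$ that permute the open cells, modulo those inducing the trivial permutation of the set of cells, with the topology having as subbasis the sets $\{f\in \operatorname{Aut}(X)\mid f(\sigma)=\tau\}$, for cells $\sigma,\tau$ of $X$. If $m\neq n$, then $\pi$ induces a homomorphism $\pi_*\colon\operatorname{Aut}(X_{m,n})\to\operatorname{Aut}(T_{m,n})$: there is exactly one homomorphism $\pi_*$ such that, whenever $\pi$ maps a cell $\sigma$ of $X_{m,n}$ into a cell $\tau$ of $T_{m,n}$, it maps the cell $f(\sigma)$ into the cell $\pi_*(f)(\tau)$, for all $f\in\operatorname{Aut}(X_{m,n})$. This homomorphism $\pi_*$ is continuous and injective. -/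

import Mathlib

namespace BaumslagSolitar

open Metric Set

/-! ### Combinatorial automorphisms of CW complexes -/

section CombinatorialAutomorphisms

variable (X : Type*) [TopologicalSpace X] [Topology.CWComplex (univ : Set X)]

/-- The set of open cells (of all dimensions) of the CW complex `X`. -/
def openCells : Set (Set X) :=
  {s | ∃ (d : ℕ) (c : Topology.CWComplex.cell (univ : Set X) d), s = Topology.CWComplex.openCell (C := univ) d c}

/-- Topological automorphisms of the CW complex `X`: homeomorphisms (in both directions) carrying
open cells to open cells. -/
def topAut : Subgroup (X ≃ₜ X) where
  carrier := {f | ∀ s : Set X, f '' s ∈ openCells X ↔ s ∈ openCells X}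
  one_mem' := fun s => by
    have : ((1 : X ≃ₜ X) : X → X) '' s = s := image_id s
    rw [this]
  mul_mem' := fun {f g} hf hg s => by
    have : ((f * g : X ≃ₜ X) : X → X) '' s = f '' (g '' s) := image_comp f g s
    rw [this, hf, hg]
  inv_mem' := fun {f} hf s => by
    rw [← hf]
    have : f '' ((f⁻¹ : X ≃ₜ X) '' s) = s := f.toEquiv.image_symm_image s
    rw [this]

/-- The permutation of the set of open cells induced by a topological automorphism. -/
def cellPerm : topAut X →* Equiv.Perm (openCells X) where
  toFun f :=
    { toFun := fun σ => ⟨f.1 '' σ.1, (f.2 σ.1).2 σ.2⟩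
      invFun := fun σ => ⟨(f⁻¹).1 '' σ.1, ((f⁻¹).2 σ.1).2 σ.2⟩
      left_inv := fun σ => Subtype.ext (f.1.toEquiv.symm_image_image σ.1)
      right_inv := fun σ => Subtype.ext (f.1.toEquiv.image_symm_image σ.1) }
  map_one' := Equiv.ext fun σ => Subtype.ext (image_id σ.1)
  map_mul' := fun f g => Equiv.ext fun σ => Subtype.ext (image_comp f.1 g.1 σ.1)

/-- The combinatorial automorphism group `Aut(X)`: topological automorphisms, where two of them are
identified if they induce the same permutation of the cells. -/
def CombAut : Type _ := topAut X ⧸ (cellPerm X).ker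

instance : Group (CombAut X) := inferInstanceAs (Group (topAut X ⧸ (cellPerm X).ker))

/-- The (faithful) action of `Aut(X)` on the set of cells of `X`. -/
def CombAut.onCells : CombAut X →* Equiv.Perm (openCells X) := QuotientGroup.kerLift (cellPerm X)

/-- The topology on `Aut(X)` with subbasis the sets `{f | f(σ) = τ}`, for cells `σ`, `τ`. -/
instance : TopologicalSpace (CombAut X) :=
  TopologicalSpace.generateFrom
    {U | ∃ σ τ : openCells X, U = {f : CombAut X | CombAut.onCells X f σ = τ}}

/-- `φ : Aut(X) → Aut(Y)` is the homomorphism induced by a map `p : X → Y` that carries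
each open cell into an open cell: if `p` maps the cell `σ` into the cell `τ`, then it maps the cell
`f(σ)` into the cell `φ(f)(τ)`. -/
def IsInducedBy {X Y : Type*} [TopologicalSpace X] [Topology.CWComplex (univ : Set X)]
    [TopologicalSpace Y] [Topology.CWComplex (univ : Set Y)] (p : X → Y)
    (φ : CombAut X →* CombAut Y) : Prop :=
  ∀ (f : CombAut X) (σ : openCells X) (τ : openCells Y), MapsTo p σ.1 τ.1 →
    MapsTo p (CombAut.onCells X f σ).1 (CombAut.onCells Y (φ f) τ).1

end CombinatorialAutomorphisms

/-! ### Gluing cells -/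

/-- A point of a cell complex with `d`-cells `Cell d`: a cell together with a point in
the open unit ball (for the maximum norm). -/
structure CellPoint (Cell : ℕ → Type) where
  dim : ℕ
  cell : Cell dim
  coord : Fin dim → ℝ
  mem : coord ∈ ball (0 : Fin dim → ℝ) 1

/-- The characteristic map of the `d`-cell `c` with attaching map `att`: the values of `att` matter
on the unit sphere only, and those of the characteristic map on the closed unit ball only. -/
noncomputable def charMap {Cell : ℕ → Type} {d : ℕ} (c : Cell d)
    (att : (Fin d → ℝ) → CellPoint Cell) (x : Fin d → ℝ) : CellPoint Cell :=
  open Classical in if h : x ∈ ball (0 : Fin d → ℝ) 1 then ⟨d, c, x, h⟩ else att x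

/-- Data for building a CW complex: cells, and attaching maps that send the unit sphere
continuously to a union of finitely many cells of lower dimension. -/
structure CellGluing where
  Cell : ℕ → Type
  att : ∀ d : ℕ, Cell d → (Fin d → ℝ) → CellPoint Cell
  dim_lt : ∀ (d : ℕ) (c : Cell d), ∀ x ∈ sphere (0 : Fin d → ℝ) 1, (att d c x).dim < d
  finite : ∀ (d : ℕ) (c : Cell d),
    ((fun x => (⟨_, (att d c x).cell⟩ : Σ e, Cell e)) '' sphere (0 : Fin d → ℝ) 1).Finite
  continuous : ∀ (d : ℕ) (c : Cell d) (A : Set (CellPoint Cell)),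
    (∀ e < d, ∀ b : Cell e, IsClosed (closedBall 0 1 ∩ charMap b (att e b) ⁻¹' A)) →
      IsClosed (sphere 0 1 ∩ att d c ⁻¹' A)

/-- The space obtained by gluing the cells along the attaching maps. -/
def CellGluing.Space (G : CellGluing) : Type := CellPoint G.Cell

/-- The characteristic map of a cell. -/
noncomputable def CellGluing.map (G : CellGluing) {d : ℕ} (c : G.Cell d) (x : Fin d → ℝ) :
    G.Space :=
  charMap c (G.att d c) x

/-- The weak topology: the finest one for which all characteristic maps are continuous on the
closed unit ball. -/
noncomputable instance (G : CellGluing) : TopologicalSpace G.Space :=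
  ⨆ (d : ℕ) (c : G.Cell d), TopologicalSpace.coinduced
    (fun x : closedBall (0 : Fin d → ℝ) 1 => G.map c x.1) inferInstance

namespace CellGluing

variable (G : CellGluing)

theorem isClosed_iff (A : Set G.Space) : IsClosed A ↔
    ∀ (d : ℕ) (c : G.Cell d), IsClosed (closedBall 0 1 ∩ G.map c ⁻¹' A) := by
  refine isClosed_iSup_iff.trans (forall_congr' fun d => ?_)
  refine isClosed_iSup_iff.trans (forall_congr' fun c => ?_)
  rw [isClosed_coinduced, (isClosed_closedBall (x := (0 : Fin d → ℝ)) (ε := 1)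
    ).isClosedEmbedding_subtypeVal.isClosed_iff_image_isClosed]
  have : Subtype.val '' ((fun x : closedBall (0 : Fin d → ℝ) 1 => G.map c x.1) ⁻¹' A)
      = closedBall 0 1 ∩ G.map c ⁻¹' A := by
    ext x; simp [and_comm]
  rw [this]

theorem map_of_mem {d : ℕ} (c : G.Cell d) {x : Fin d → ℝ} (h : x ∈ ball (0 : Fin d → ℝ) 1) :
    G.map c x = (⟨d, c, x, h⟩ : CellPoint G.Cell) := dif_pos h

theorem dim_map {d : ℕ} (c : G.Cell d) {x : Fin d → ℝ} (h : x ∈ ball (0 : Fin d → ℝ) 1) :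
    CellPoint.dim (G.map c x) = d := by
  rw [map_of_mem _ _ h]

theorem map_inj {d e : ℕ} {c : G.Cell d} {b : G.Cell e} {x : Fin d → ℝ} {y : Fin e → ℝ}
    (hx : x ∈ ball (0 : Fin d → ℝ) 1) (hy : y ∈ ball (0 : Fin e → ℝ) 1)
    (h : G.map c x = G.map b y) : (⟨d, c⟩ : Σ e, G.Cell e) = ⟨e, b⟩ ∧ x ≍ y := by
  rw [map_of_mem _ _ hx, map_of_mem _ _ hy] at h
  have h' := (CellPoint.mk.injEq (Cell := G.Cell) ..).mp h
  exact ⟨Sigma.ext h'.1 h'.2.1, h'.2.2⟩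

theorem map_of_notMem {d : ℕ} (c : G.Cell d) {x : Fin d → ℝ}
    (h : x ∉ ball (0 : Fin d → ℝ) 1) : G.map c x = G.att d c x := dif_neg h

theorem notMem_ball_of_mem_sphere {d : ℕ} {x : Fin d → ℝ}
    (h : x ∈ sphere (0 : Fin d → ℝ) 1) : x ∉ ball (0 : Fin d → ℝ) 1 :=
  fun h' => (ne_of_lt (mem_ball.1 h')) (mem_sphere.1 h)

theorem continuousOn_map {d : ℕ} (c : G.Cell d) : ContinuousOn (G.map c) (closedBall 0 1) := by
  rw [continuousOn_iff_continuous_domRestrict]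
  rw [continuous_iff_coinduced_le]
  exact le_iSup_of_le d (le_iSup_of_le c le_rfl)

/-- A characteristic map as a bijection from the open unit ball to the open cell. -/
noncomputable def mapEquiv {d : ℕ} (c : G.Cell d) : PartialEquiv (Fin d → ℝ) G.Space where
  toFun := G.map c
  invFun := fun p : CellPoint G.Cell =>
    open Classical in if h : p.dim = d then fun i => p.coord (Fin.cast h.symm i) else 0
  source := ball 0 1
  target := G.map c '' ball 0 1
  map_source' := fun _ h => mem_image_of_mem _ h
  map_target' := by
    rintro _ ⟨x, h, rfl⟩
    rw [map_of_mem _ _ h]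
    simpa using h
  left_inv' := by
    intro x h
    rw [map_of_mem _ _ h]
    simp
  right_inv' := by
    rintro _ ⟨x, h, rfl⟩
    rw [map_of_mem _ _ h]
    simp only [dite_true, Fin.cast_eq_self]
    exact map_of_mem _ _ h

theorem isClosed_of_dim_le {d : ℕ} {A : Set G.Space}
    (hA : ∀ p : CellPoint G.Cell, p ∈ A → p.dim ≤ d)
    (h : ∀ e ≤ d, ∀ b : G.Cell e, IsClosed (closedBall 0 1 ∩ G.map b ⁻¹' A)) : IsClosed A := by
  rw [isClosed_iff]
  intro e
  induction e using Nat.strong_induction_on with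
  | _ e ih =>
    intro b
    by_cases he : e ≤ d
    · exact h e he b
    · convert G.continuous e b A ih using 1
      ext x
      simp only [mem_inter_iff, mem_preimage]
      constructor
      · rintro ⟨hx, hxA⟩
        have hb : x ∉ ball (0 : Fin e → ℝ) 1 := by
          intro hb
          rw [map_of_mem _ _ hb] at hxA
          exact he (hA _ hxA)
        rw [map_of_notMem _ _ hb] at hxA
        refine ⟨?_, hxA⟩
        rw [mem_sphere]
        rw [mem_ball, not_lt] at hb
        exact le_antisymm (mem_closedBall.1 hx) hb
      · rintro ⟨hx, hxA⟩
        rw [map_of_notMem _ _ (notMem_ball_of_mem_sphere hx)]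
        exact ⟨sphere_subset_closedBall hx, hxA⟩

theorem continuousOn_mapEquiv_symm {d : ℕ} (c : G.Cell d) :
    ContinuousOn (G.mapEquiv c).symm (G.mapEquiv c).target := by
  rw [continuousOn_iff_isClosed]
  intro K hK
  let W : Set G.Space := {p | CellPoint.dim p < d} ∪ G.map c '' (ball 0 1 ∩ K)
  refine ⟨W, ?_, ?_⟩
  · refine G.isClosed_of_dim_le (d := d) ?_ ?_
    · rintro p (hp | ⟨x, hx, rfl⟩)
      · exact le_of_lt hp
      · rw [map_of_mem _ _ hx.1]
    · intro e he b
      have key : ∀ x ∈ sphere (0 : Fin e → ℝ) 1, G.map b x ∈ W := by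
        intro x hx
        left
        rw [map_of_notMem _ _ (notMem_ball_of_mem_sphere hx)]
        exact (G.dim_lt e b x hx).trans_le he
      by_cases heq : (⟨e, b⟩ : Σ e, G.Cell e) = ⟨d, c⟩
      · obtain ⟨rfl, h2⟩ := Sigma.mk.inj_iff.1 heq
        obtain rfl := eq_of_heq h2
        have : closedBall 0 1 ∩ G.map b ⁻¹' W = sphere 0 1 ∪ (closedBall 0 1 ∩ K) := by
          ext x
          constructor
          · rintro ⟨hx, hxW⟩
            rcases (mem_closedBall.1 hx).lt_or_eq with h | h
            · right
              refine ⟨hx, ?_⟩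
              rcases hxW with hxW | ⟨y, hy, hyx⟩
              · exact absurd (G.dim_map b (mem_ball.2 h)) (ne_of_lt hxW)
              · rw [← eq_of_heq (G.map_inj hy.1 h hyx).2]
                exact hy.2
            · exact Or.inl h
          · rintro (hx | ⟨hx, hxK⟩)
            · exact ⟨sphere_subset_closedBall hx, key x hx⟩
            · refine ⟨hx, ?_⟩
              rcases (mem_closedBall.1 hx).lt_or_eq with h | h
              · exact Or.inr ⟨x, ⟨h, hxK⟩, rfl⟩
              · exact key x h
        rw [this]
        exact isClosed_sphere.union (isClosed_closedBall.inter hK)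
      · rcases he.lt_or_eq with hlt | hed
        · have : closedBall 0 1 ∩ G.map b ⁻¹' W = closedBall 0 1 := by
            refine inter_eq_left.2 fun x hx => ?_
            rcases (mem_closedBall.1 hx).lt_or_eq with h | h
            · left
              rw [map_of_mem _ _ (mem_ball.2 h)]
              exact hlt
            · exact key x h
          rw [this]
          exact isClosed_closedBall
        · have : closedBall 0 1 ∩ G.map b ⁻¹' W = sphere 0 1 := by
            ext x
            constructor
            · rintro ⟨hx, hxW⟩
              rcases (mem_closedBall.1 hx).lt_or_eq with h | h
              · exfalso
                rcases hxW with hxW | ⟨y, hy, hyx⟩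
                · exact absurd ((G.dim_map b (mem_ball.2 h)).trans hed) (ne_of_lt hxW)
                · exact heq (G.map_inj hy.1 h hyx).1.symm
              · exact h
            · exact fun hx => ⟨sphere_subset_closedBall hx, key x hx⟩
          rw [this]
          exact isClosed_sphere
  · ext p
    constructor
    · rintro ⟨hp, x, hx, rfl⟩
      refine ⟨Or.inr ⟨x, ⟨hx, ?_⟩, rfl⟩, x, hx, rfl⟩
      have : (G.mapEquiv c).symm (G.map c x) = x := (G.mapEquiv c).left_inv hx
      rw [mem_preimage, this] at hp
      exact hp
    · rintro ⟨hp, x, hx, rfl⟩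
      refine ⟨?_, x, hx, rfl⟩
      rcases hp with hp | ⟨y, hy, hyx⟩
      · exact absurd (G.dim_map c hx) (ne_of_lt hp)
      · rw [← hyx, mem_preimage]
        have : (G.mapEquiv c).symm (G.map c y) = y := (G.mapEquiv c).left_inv hy.1
        rw [this]
        exact hy.2

/-- The space obtained by gluing cells is a CW complex. -/
noncomputable instance : Topology.CWComplex (univ : Set G.Space) where
  cell := G.Cell
  map _ c := G.mapEquiv c
  source_eq _ _ := rfl
  continuousOn _ c := G.continuousOn_map c
  continuousOn_symm _ c := G.continuousOn_mapEquiv_symm c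
  pairwiseDisjoint' := by
    rintro ⟨d, c⟩ - ⟨e, b⟩ - hne
    refine disjoint_left.2 ?_
    rintro _ ⟨x, hx, rfl⟩ ⟨y, hy, hyx⟩
    exact hne (G.map_inj hy hx hyx).1.symm
  mapsTo' d c := by
    refine ⟨fun e => ((G.finite d c).preimage
      (sigma_mk_injective (i := e)).injOn).toFinset, fun x hx => ?_⟩
    change G.map c x ∈ _
    rw [map_of_notMem _ _ (notMem_ball_of_mem_sphere hx)]
    refine mem_iUnion.2 ⟨_, mem_iUnion.2 ⟨G.dim_lt d c x hx, mem_iUnion.2 ⟨(G.att d c x).cell,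
      mem_iUnion.2 ⟨(Finite.mem_toFinset _).2 ⟨x, hx, rfl⟩, ?_⟩⟩⟩⟩
    refine ⟨(G.att d c x).coord, ball_subset_closedBall (G.att d c x).mem, ?_⟩
    exact map_of_mem _ _ _
  closed' A _ h := by
    rw [isClosed_iff]
    intro d c
    have := (G.continuousOn_map c).preimage_isClosed_of_isClosed isClosed_closedBall (h d c)
    convert this using 1
    ext x
    simp only [mem_inter_iff, mem_preimage]
    exact ⟨fun hx => ⟨hx.1, hx.2, x, hx.1, rfl⟩, fun hx => ⟨hx.1, hx.2.1⟩⟩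
  union' := by
    refine eq_univ_of_forall fun p => ?_
    simp only [mem_iUnion]
    exact ⟨CellPoint.dim p, CellPoint.cell p, CellPoint.coord p,
      ball_subset_closedBall (CellPoint.mem p), map_of_mem _ _ _⟩

end CellGluing

/-! ### Points on vertices and edges -/

section EdgePoints

variable {Cell : ℕ → Type}

/-- The point of a `0`-cell. -/
def vertexPoint (p : Cell 0) : CellPoint Cell := ⟨0, p, 0, mem_ball_self one_pos⟩

/-- The attaching map of an edge from the vertex `p` to the vertex `q`. -/
noncomputable def edgeAtt (p q : Cell 0) (x : Fin 1 → ℝ) : CellPoint Cell :=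
  if x 0 < 0 then vertexPoint p else vertexPoint q

/-- The point with parameter `s ∈ [-1, 1]` on the edge `e` from the vertex `p` to the
vertex `q`. -/
noncomputable def edgePoint (e : Cell 1) (p q : Cell 0) (s : ℝ) : CellPoint Cell :=
  charMap e (edgeAtt p q) (fun _ => s)

theorem edgePoint_neg_one (e : Cell 1) (p q : Cell 0) : edgePoint e p q (-1) = vertexPoint p := by
  simp [edgePoint, charMap, edgeAtt]

theorem edgePoint_one (e : Cell 1) (p q : Cell 0) : edgePoint e p q 1 = vertexPoint q := by
  simp [edgePoint, charMap, edgeAtt]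

theorem edgePoint_cell (e : Cell 1) (p q : Cell 0) (s : ℝ) :
    (⟨_, (edgePoint e p q s).cell⟩ : Σ d, Cell d) ∈
      ({⟨1, e⟩, ⟨0, p⟩, ⟨0, q⟩} : Set (Σ d, Cell d)) := by
  by_cases h : (fun _ => s : Fin 1 → ℝ) ∈ ball (0 : Fin 1 → ℝ) 1
  · rw [edgePoint, charMap, dif_pos h]
    exact Or.inl rfl
  rw [edgePoint, charMap, dif_neg h, edgeAtt]
  by_cases h' : s < 0
  · rw [if_pos h']
    exact Or.inr (Or.inl rfl)
  · rw [if_neg h']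
    exact Or.inr (Or.inr rfl)

theorem edgePoint_dim (e : Cell 1) (p q : Cell 0) (s : ℝ) : (edgePoint e p q s).dim < 2 := by
  unfold edgePoint charMap edgeAtt
  split_ifs <;> simp [vertexPoint]

theorem edgeAtt_dim (p q : Cell 0) (x : Fin 1 → ℝ) : (edgeAtt p q x).dim < 1 := by
  unfold edgeAtt
  split_ifs <;> simp [vertexPoint]

theorem edgeAtt_finite (p q : Cell 0) (S : Set (Fin 1 → ℝ)) :
    ((fun x => (⟨_, (edgeAtt p q x).cell⟩ : Σ d, Cell d)) '' S).Finite := by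
  refine (Set.toFinite {(⟨0, p⟩ : Σ d, Cell d), ⟨0, q⟩}).subset ?_
  rintro _ ⟨x, -, rfl⟩
  dsimp only
  rw [edgeAtt]
  by_cases h : x 0 < 0
  · rw [if_pos h]
    exact Or.inl rfl
  · rw [if_neg h]
    exact Or.inr rfl

theorem edgeAtt_closed (p q : Cell 0) (A : Set (CellPoint Cell)) :
    IsClosed (sphere 0 1 ∩ edgeAtt p q ⁻¹' A) := by
  refine Set.Finite.isClosed ((Set.toFinite {fun _ => 1, fun _ => -1}).subset ?_)
  rintro x ⟨hx, -⟩
  have h : |x 0| = 1 := by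
    have : ‖x‖ = 1 := mem_sphere_zero_iff_norm.1 hx
    rw [← this, ← Real.norm_eq_abs]
    refine le_antisymm (norm_le_pi_norm x 0) ((pi_norm_le_iff_of_nonneg (norm_nonneg _)).2 ?_)
    intro i
    rw [Subsingleton.elim i 0]
  rcases eq_or_eq_neg_of_abs_eq h with h | h
  · left
    funext i
    rw [Subsingleton.elim i 0, h]
  · right
    funext i
    rw [Subsingleton.elim i 0, h]

theorem edgePoint_closed (e : Cell 1) (p q : Cell 0) (A : Set (CellPoint Cell))
    (h : IsClosed (closedBall 0 1 ∩ charMap e (edgeAtt p q) ⁻¹' A)) :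
    IsClosed {s : ℝ | s ∈ Icc (-1) 1 ∧ edgePoint e p q s ∈ A} := by
  have hc : Continuous (fun (s : ℝ) (_ : Fin 1) => s) := by fun_prop
  convert h.preimage hc using 1
  ext s
  simp [edgePoint, abs_le, pi_norm_const]

end EdgePoints

/-! ### The Baumslag-Solitar group -/

/-- The Baumslag-Solitar group `BS(m, n) = ⟨a, t | t a ^ m t⁻¹ = a ^ n⟩`. -/
def BS (m n : ℕ) : Type :=
  PresentedGroup {(FreeGroup.of 1 * FreeGroup.of 0 ^ m * (FreeGroup.of 1)⁻¹ *
    (FreeGroup.of 0 ^ n)⁻¹ : FreeGroup (Fin 2))}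

instance (m n : ℕ) : Group (BS m n) := inferInstanceAs (Group (PresentedGroup _))

namespace BS

variable (m n : ℕ)

/-- The generator `a`. -/
def a : BS m n := PresentedGroup.of 0

/-- The stable letter `t`. -/
def t : BS m n := PresentedGroup.of 1

theorem t_mul_a_pow : t m n * a m n ^ m = a m n ^ n * t m n := by
  have h := PresentedGroup.one_of_mem (rels := {(FreeGroup.of 1 * FreeGroup.of 0 ^ m *
    (FreeGroup.of 1)⁻¹ * (FreeGroup.of 0 ^ n)⁻¹ : FreeGroup (Fin 2))}) (mem_singleton _)
  simp only [map_mul, map_pow, map_inv] at h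
  exact mul_inv_eq_iff_eq_mul.1 (mul_inv_eq_one.1 h)

/-- The elements `t_i = a ^ (-i n / k) t a ^ (i m / k)`, for `i` modulo `k = gcd(m, n)`. -/
def tt (i : ZMod (m.gcd n)) : BS m n :=
  (a m n ^ (n / m.gcd n * i.val))⁻¹ * t m n * a m n ^ (m / m.gcd n * i.val)

theorem tt_mul (i : ZMod (m.gcd n)) :
    tt m n i * a m n ^ (m / m.gcd n) = a m n ^ (n / m.gcd n) * tt m n (i + 1) := by
  unfold tt
  rcases Nat.eq_zero_or_pos (m.gcd n) with hk | hk
  · simp [hk]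
  have : NeZero (m.gcd n) := ⟨hk.ne'⟩
  have hlt := ZMod.val_lt i
  have hi : ((i.val + 1 : ℕ) : ZMod (m.gcd n)) = i + 1 := by simp
  rcases (Nat.succ_le_of_lt hlt).lt_or_eq with h | h
  · have hv : (i + 1).val = i.val + 1 := by rw [← hi, ZMod.val_natCast_of_lt h]
    rw [hv, mul_add, mul_add, mul_one, mul_one, pow_add, pow_add]
    group
  · have hv : (i + 1).val = 0 := by
      rw [← hi, show i.val + 1 = m.gcd n from h]
      simp
    have h1 := t_mul_a_pow m n
    have hm : m / m.gcd n * i.val + m / m.gcd n = m := by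
      rw [← Nat.mul_succ, h]
      exact Nat.div_mul_cancel (Nat.gcd_dvd_left m n)
    have hn : n / m.gcd n * i.val + n / m.gcd n = n := by
      rw [← Nat.mul_succ, h]
      exact Nat.div_mul_cancel (Nat.gcd_dvd_right m n)
    rw [hv, mul_zero, mul_zero, pow_zero, inv_one, one_mul, mul_one, mul_assoc, ← pow_add, hm,
      mul_assoc, h1, ← mul_assoc, inv_mul_eq_iff_eq_mul.2]
    rw [← pow_add, hn]

end BS

/-! ### The complex `X_{m,n}` -/

section CayleyComplex

variable (m n : ℕ)

/-- The cells of `X_{m,n}`. With `k = gcd(m, n)`: the vertices are the elements of `BS(m, n)`, there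
are horizontal edges from `g` to `g a` and vertical edges from `g` to `g t_i`, and `face g i`
is the rectangle with lower left corner `g`, bottom side `a ^ (n / k)`,
top side `a ^ (m / k)`, left side `t_i` and right side `t_{i + 1}`. -/
inductive XCell : ℕ → Type
  | vertex (g : BS m n) : XCell 0
  | horizontal (g : BS m n) : XCell 1
  | vertical (g : BS m n) (i : ZMod (m.gcd n)) : XCell 1
  | face (g : BS m n) (i : ZMod (m.gcd n)) : XCell 2

variable {m n}

/-- The point at distance `r` from the vertex `g` on the branching line through `g`. -/
noncomputable def linePoint (g : BS m n) (r : ℝ) : CellPoint (XCell m n) :=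
  edgePoint (.horizontal (g * BS.a m n ^ ⌊r⌋)) (.vertex (g * BS.a m n ^ ⌊r⌋))
    (.vertex (g * BS.a m n ^ ⌊r⌋ * BS.a m n)) (2 * Int.fract r - 1)

/-- The point with parameter `s ∈ [-1, 1]` on the vertical edge from `g` to `g t_i`. -/
noncomputable def verticalPoint (g : BS m n) (i : ZMod (m.gcd n)) (s : ℝ) :
    CellPoint (XCell m n) :=
  edgePoint (.vertical g i) (.vertex g) (.vertex (g * BS.tt m n i)) s

/-- The attaching map of the face `face g i`, on the boundary of the square `[-1, 1] × [-1, 1]`. -/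
noncomputable def faceAtt (g : BS m n) (i : ZMod (m.gcd n)) (x : Fin 2 → ℝ) :
    CellPoint (XCell m n) :=
  if x 1 = -1 then linePoint g ((n / m.gcd n : ℕ) * ((x 0 + 1) / 2))
  else if x 1 = 1 then linePoint (g * BS.tt m n i) ((m / m.gcd n : ℕ) * ((x 0 + 1) / 2))
  else if x 0 = -1 then verticalPoint g i (x 1)
  else verticalPoint (g * BS.a m n ^ (n / m.gcd n)) (i + 1) (x 1)

/-- The attaching maps of `X_{m,n}`. -/
noncomputable def XAtt : ∀ d : ℕ, XCell m n d → (Fin d → ℝ) → CellPoint (XCell m n)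
  | _, .vertex g => fun _ => vertexPoint (.vertex g)
  | _, .horizontal g => edgeAtt (.vertex g) (.vertex (g * BS.a m n))
  | _, .vertical g i => edgeAtt (.vertex g) (.vertex (g * BS.tt m n i))
  | _, .face g i => faceAtt g i

theorem linePoint_eq (g : BS m n) (j : ℕ) {r : ℝ} (hr : r ∈ Icc (j : ℝ) (j + 1)) :
    linePoint g r = edgePoint (.horizontal (g * BS.a m n ^ j)) (.vertex (g * BS.a m n ^ j))
      (.vertex (g * BS.a m n ^ j * BS.a m n)) (2 * (r - j) - 1) := by
  rcases hr.2.lt_or_eq with h | h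
  · have hf : ⌊r⌋ = (j : ℤ) := Int.floor_eq_iff.2 ⟨by exact_mod_cast hr.1, by exact_mod_cast h⟩
    rw [linePoint, Int.fract, hf, zpow_natCast, Int.cast_natCast]
  · have hf : ⌊r⌋ = ((j + 1 : ℕ) : ℤ) := by
      rw [h]
      exact_mod_cast Int.floor_natCast (R := ℝ) (j + 1)
    rw [linePoint, Int.fract, hf, zpow_natCast, Int.cast_natCast, h]
    have e1 : 2 * ((j : ℝ) + 1 - ((j + 1 : ℕ) : ℝ)) - 1 = -1 := by push_cast; ring
    have e2 : 2 * ((j : ℝ) + 1 - (j : ℝ)) - 1 = 1 := by ring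
    rw [e1, e2, edgePoint_neg_one, edgePoint_one, pow_succ, mul_assoc]

theorem linePoint_natCast (g : BS m n) (j : ℕ) :
    linePoint g j = vertexPoint (.vertex (g * BS.a m n ^ j)) := by
  rw [linePoint_eq g j ⟨le_rfl, by linarith⟩, sub_self, mul_zero, zero_sub, edgePoint_neg_one]

theorem linePoint_dim (g : BS m n) (r : ℝ) : (linePoint g r).dim < 2 := edgePoint_dim _ _ _ _

theorem linePoint_finite (g : BS m n) (N : ℕ) :
    ((fun r => (⟨_, (linePoint g r).cell⟩ : Σ d, XCell m n d)) '' Icc (0 : ℝ) N).Finite := by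
  refine ((Set.finite_le_nat N).biUnion (t := fun j => {⟨1, .horizontal (g * BS.a m n ^ j)⟩,
    ⟨0, .vertex (g * BS.a m n ^ j)⟩, ⟨0, .vertex (g * BS.a m n ^ j * BS.a m n)⟩})
    fun j _ => Set.toFinite _).subset ?_
  rintro _ ⟨r, hr, rfl⟩
  refine mem_iUnion₂.2 ⟨⌊r⌋₊, Nat.floor_le_of_le hr.2, ?_⟩
  dsimp only
  rw [linePoint_eq g ⌊r⌋₊ ⟨Nat.floor_le hr.1, (Nat.lt_floor_add_one r).le⟩]
  exact edgePoint_cell _ _ _ _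

theorem linePoint_closed (g : BS m n) (N : ℕ) (A : Set (CellPoint (XCell m n)))
    (h : ∀ b : XCell m n 1, IsClosed (closedBall 0 1 ∩ charMap b (XAtt 1 b) ⁻¹' A)) :
    IsClosed {r : ℝ | r ∈ Icc 0 (N : ℝ) ∧ linePoint g r ∈ A} := by
  have key : ∀ j : ℕ, IsClosed {r : ℝ | r ∈ Icc (j : ℝ) (j + 1) ∧ linePoint g r ∈ A} := by
    intro j
    have h1 := edgePoint_closed _ _ _ A (h (.horizontal (g * BS.a m n ^ j)))
    have hc : Continuous (fun r : ℝ => 2 * (r - j) - 1) := by fun_prop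
    convert h1.preimage hc using 1
    ext r
    simp only [mem_ofPred_eq, mem_preimage]
    constructor
    · rintro ⟨hr, hA⟩
      rw [linePoint_eq g j hr] at hA
      exact ⟨⟨by linarith [hr.1], by linarith [hr.2]⟩, hA⟩
    · rintro ⟨hr, hA⟩
      have hr' : r ∈ Icc (j : ℝ) (j + 1) := ⟨by linarith [hr.1], by linarith [hr.2]⟩
      rw [linePoint_eq g j hr']
      exact ⟨hr', hA⟩
  convert (isClosed_Icc (a := (0 : ℝ)) (b := N)).inter
    ((Set.finite_le_nat N).isClosed_biUnion fun j _ => key j) using 1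
  ext r
  simp only [mem_ofPred_eq, mem_inter_iff, mem_iUnion]
  constructor
  · rintro ⟨hr, hA⟩
    exact ⟨hr, ⌊r⌋₊, Nat.floor_le_of_le hr.2,
      ⟨Nat.floor_le hr.1, (Nat.lt_floor_add_one r).le⟩, hA⟩
  · rintro ⟨hr, j, -, -, hA⟩
    exact ⟨hr, hA⟩

theorem mem_sphere_two {x : Fin 2 → ℝ} : x ∈ sphere (0 : Fin 2 → ℝ) 1 ↔
    (x 0 ∈ Icc (-1 : ℝ) 1 ∧ x 1 ∈ Icc (-1 : ℝ) 1) ∧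
      (x 1 = -1 ∨ x 1 = 1 ∨ x 0 = -1 ∨ x 0 = 1) := by
  have h1 : ‖x‖ ≤ 1 ↔ |x 0| ≤ 1 ∧ |x 1| ≤ 1 := by
    rw [pi_norm_le_iff_of_nonneg zero_le_one]
    simp [Fin.forall_fin_two]
  have h2 : ‖x‖ < 1 ↔ |x 0| < 1 ∧ |x 1| < 1 := by
    rw [pi_norm_lt_iff zero_lt_one]
    simp [Fin.forall_fin_two]
  rw [mem_sphere_zero_iff_norm, le_antisymm_iff, ← not_lt (a := ‖x‖), h1, h2]
  simp only [abs_le, abs_lt, mem_Icc]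
  constructor
  · rintro ⟨⟨⟨h3, h4⟩, h5, h6⟩, h7⟩
    refine ⟨⟨⟨h3, h4⟩, h5, h6⟩, ?_⟩
    by_contra! hcon
    exact h7 ⟨⟨lt_of_le_of_ne h3 (Ne.symm hcon.2.2.1), lt_of_le_of_ne h4 hcon.2.2.2⟩,
      lt_of_le_of_ne h5 (Ne.symm hcon.1), lt_of_le_of_ne h6 hcon.2.1⟩
  · rintro ⟨⟨⟨h3, h4⟩, h5, h6⟩, h7⟩
    refine ⟨⟨⟨h3, h4⟩, h5, h6⟩, ?_⟩
    rintro ⟨⟨h8, h9⟩, h10, h11⟩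
    rcases h7 with h | h | h | h <;> linarith

theorem faceAtt_bottom (g : BS m n) (i : ZMod (m.gcd n)) {x : Fin 2 → ℝ} (h : x 1 = -1) :
    faceAtt g i x = linePoint g ((n / m.gcd n : ℕ) * ((x 0 + 1) / 2)) := if_pos h

theorem faceAtt_top (g : BS m n) (i : ZMod (m.gcd n)) {x : Fin 2 → ℝ} (h : x 1 = 1) :
    faceAtt g i x = linePoint (g * BS.tt m n i) ((m / m.gcd n : ℕ) * ((x 0 + 1) / 2)) := by
  have : x 1 ≠ -1 := by rw [h]; norm_num
  rw [faceAtt, if_neg this, if_pos h]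

theorem faceAtt_left (g : BS m n) (i : ZMod (m.gcd n)) {x : Fin 2 → ℝ} (h : x 0 = -1) :
    faceAtt g i x = verticalPoint g i (x 1) := by
  by_cases h1 : x 1 = -1
  · rw [faceAtt_bottom _ _ h1, h1, h, verticalPoint, edgePoint_neg_one]
    simpa using linePoint_natCast g 0
  by_cases h2 : x 1 = 1
  · rw [faceAtt_top _ _ h2, h2, h, verticalPoint, edgePoint_one]
    simpa using linePoint_natCast (g * BS.tt m n i) 0
  rw [faceAtt, if_neg h1, if_neg h2, if_pos h]

theorem faceAtt_right (g : BS m n) (i : ZMod (m.gcd n)) {x : Fin 2 → ℝ} (h : x 0 = 1) :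
    faceAtt g i x = verticalPoint (g * BS.a m n ^ (n / m.gcd n)) (i + 1) (x 1) := by
  have e : ((1 : ℝ) + 1) / 2 = 1 := by norm_num
  by_cases h1 : x 1 = -1
  · rw [faceAtt_bottom _ _ h1, h1, h, verticalPoint, edgePoint_neg_one, e, mul_one]
    exact linePoint_natCast g _
  by_cases h2 : x 1 = 1
  · rw [faceAtt_top _ _ h2, h2, h, verticalPoint, edgePoint_one, e, mul_one, linePoint_natCast,
      mul_assoc, BS.tt_mul, mul_assoc]
  have h3 : x 0 ≠ -1 := by rw [h]; norm_num
  rw [faceAtt, if_neg h1, if_neg h2, if_neg h3]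

theorem mul_half_mem {N : ℕ} {y : ℝ} (hy : y ∈ Icc (-1 : ℝ) 1) :
    (N : ℝ) * ((y + 1) / 2) ∈ Icc (0 : ℝ) N := by
  have h0 : 0 ≤ (y + 1) / 2 := by linarith [hy.1]
  have h1 : (y + 1) / 2 ≤ 1 := by linarith [hy.2]
  exact ⟨mul_nonneg N.cast_nonneg h0, mul_le_of_le_one_right N.cast_nonneg h1⟩

theorem faceAtt_finite (g : BS m n) (i : ZMod (m.gcd n)) :
    ((fun x => (⟨_, (faceAtt g i x).cell⟩ : Σ d, XCell m n d)) ''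
      sphere (0 : Fin 2 → ℝ) 1).Finite := by
  let S (g : BS m n) (i : ZMod (m.gcd n)) : Set (Σ d, XCell m n d) :=
    {⟨1, .vertical g i⟩, ⟨0, .vertex g⟩, ⟨0, .vertex (g * BS.tt m n i)⟩}
  refine (((linePoint_finite g (n / m.gcd n)).union
    (linePoint_finite (g * BS.tt m n i) (m / m.gcd n))).union
    ((Set.toFinite (S g i)).union
      (Set.toFinite (S (g * BS.a m n ^ (n / m.gcd n)) (i + 1))))).subset ?_
  rintro _ ⟨x, hx, rfl⟩
  obtain ⟨⟨h0, -⟩, h | h | h | h⟩ := mem_sphere_two.1 hx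
  · refine Or.inl (Or.inl ⟨_, mul_half_mem h0, ?_⟩)
    dsimp only
    rw [faceAtt_bottom _ _ h]
  · refine Or.inl (Or.inr ⟨_, mul_half_mem h0, ?_⟩)
    dsimp only
    rw [faceAtt_top _ _ h]
  · refine Or.inr (Or.inl ?_)
    dsimp only
    rw [faceAtt_left _ _ h]
    exact edgePoint_cell _ _ _ _
  · refine Or.inr (Or.inr ?_)
    dsimp only
    rw [faceAtt_right _ _ h]
    exact edgePoint_cell _ _ _ _

theorem faceAtt_closed (g : BS m n) (i : ZMod (m.gcd n)) (A : Set (CellPoint (XCell m n)))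
    (h : ∀ b : XCell m n 1, IsClosed (closedBall 0 1 ∩ charMap b (XAtt 1 b) ⁻¹' A)) :
    IsClosed (sphere 0 1 ∩ faceAtt g i ⁻¹' A) := by
  have line (g : BS m n) (N : ℕ) (s : ℝ) : IsClosed {x : Fin 2 → ℝ | x 1 = s ∧
      (N : ℝ) * ((x 0 + 1) / 2) ∈ Icc (0 : ℝ) N ∧ linePoint g (N * ((x 0 + 1) / 2)) ∈ A} := by
    have hc : Continuous (fun x : Fin 2 → ℝ => (N : ℝ) * ((x 0 + 1) / 2)) := by fun_prop
    exact (isClosed_eq (continuous_apply 1) continuous_const).inter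
      ((linePoint_closed g N A h).preimage hc)
  have vert (g : BS m n) (i : ZMod (m.gcd n)) (s : ℝ) : IsClosed {x : Fin 2 → ℝ | x 0 = s ∧
      x 1 ∈ Icc (-1 : ℝ) 1 ∧ verticalPoint g i (x 1) ∈ A} := by
    have hc : Continuous (fun x : Fin 2 → ℝ => x 1) := by fun_prop
    exact (isClosed_eq (continuous_apply 0) continuous_const).inter
      ((edgePoint_closed _ _ _ A (h (.vertical g i))).preimage hc)
  have hcl := (isClosed_sphere (x := (0 : Fin 2 → ℝ)) (ε := 1)).inter
    (((line g (n / m.gcd n) (-1)).union (line (g * BS.tt m n i) (m / m.gcd n) 1)).union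
    ((vert g i (-1)).union (vert (g * BS.a m n ^ (n / m.gcd n)) (i + 1) 1)))
  suffices hs : sphere 0 1 ∩ faceAtt g i ⁻¹' A = _ from hs ▸ hcl
  ext x
  refine and_congr_right fun hx => ?_
  obtain ⟨⟨h0, h1⟩, h4⟩ := mem_sphere_two.1 hx
  simp only [mem_preimage, mem_union, mem_ofPred_eq]
  constructor
  · intro hA
    rcases h4 with h | h | h | h
    · rw [faceAtt_bottom _ _ h] at hA
      exact Or.inl (Or.inl ⟨h, mul_half_mem h0, hA⟩)
    · rw [faceAtt_top _ _ h] at hA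
      exact Or.inl (Or.inr ⟨h, mul_half_mem h0, hA⟩)
    · rw [faceAtt_left _ _ h] at hA
      exact Or.inr (Or.inl ⟨h, h1, hA⟩)
    · rw [faceAtt_right _ _ h] at hA
      exact Or.inr (Or.inr ⟨h, h1, hA⟩)
  · rintro ((⟨h, -, hA⟩ | ⟨h, -, hA⟩) | (⟨h, -, hA⟩ | ⟨h, -, hA⟩))
    · rwa [faceAtt_bottom _ _ h]
    · rwa [faceAtt_top _ _ h]
    · rwa [faceAtt_left _ _ h]
    · rwa [faceAtt_right _ _ h]

theorem faceAtt_dim (g : BS m n) (i : ZMod (m.gcd n)) (x : Fin 2 → ℝ) :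
    (faceAtt g i x).dim < 2 := by
  unfold faceAtt
  split_ifs <;> exact edgePoint_dim _ _ _ _

variable (m n)

/-- The gluing data of `X_{m,n}`. -/
noncomputable def XGluing : CellGluing where
  Cell := XCell m n
  att := XAtt
  dim_lt := by
    rintro _ (_ | _ | _ | _) x hx
    · simp [sphere_eq_empty_of_subsingleton] at hx
    · exact edgeAtt_dim _ _ _
    · exact edgeAtt_dim _ _ _
    · exact faceAtt_dim _ _ _
  finite := by
    rintro _ (_ | _ | _ | _)
    · simp [sphere_eq_empty_of_subsingleton]
    · exact edgeAtt_finite _ _ _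
    · exact edgeAtt_finite _ _ _
    · exact faceAtt_finite _ _
  continuous := by
    rintro _ (_ | _ | _ | _) A hA
    · simp [sphere_eq_empty_of_subsingleton]
    · exact edgeAtt_closed _ _ _
    · exact edgeAtt_closed _ _ _
    · exact faceAtt_closed _ _ _ (hA 1 (by norm_num))

/-- The CW complex `X_{m,n}`: the universal cover of the presentation complex of
`⟨a, t_0, …, t_{k-1} | t_i a ^ (m / k) = a ^ (n / k) t_{i+1}⟩ = BS(m, n)` (indices modulo
`k = gcd(m, n)`), that is, the Cayley complex of this presentation. -/
abbrev X : Type := (XGluing m n).Space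

end CayleyComplex

/-! ### The tree `T_{m,n}` -/

section BassSerreTree

variable (m n : ℕ)

/-- The vertices and edges of the Bass-Serre tree of `BS(m, n)`, the HNN extension of `⟨a⟩` with
edge group `⟨a ^ n⟩`. -/
inductive TCell : ℕ → Type
  | vertex (v : BS m n ⧸ Subgroup.zpowers (BS.a m n)) : TCell 0
  | edge (e : BS m n ⧸ Subgroup.zpowers (BS.a m n ^ n)) : TCell 1

variable {m n}

/-- The initial vertex `g ⟨a⟩` of the edge `g ⟨a ^ n⟩`. -/
def source (e : BS m n ⧸ Subgroup.zpowers (BS.a m n ^ n)) :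
    BS m n ⧸ Subgroup.zpowers (BS.a m n) :=
  Quotient.map' id (fun g h hgh => by
    rw [QuotientGroup.leftRel_apply] at hgh ⊢
    exact Subgroup.zpowers_le.2 (pow_mem (Subgroup.mem_zpowers _) n) hgh) e

/-- The terminal vertex `g t ⟨a⟩` of the edge `g ⟨a ^ n⟩`. -/
def target (e : BS m n ⧸ Subgroup.zpowers (BS.a m n ^ n)) :
    BS m n ⧸ Subgroup.zpowers (BS.a m n) :=
  Quotient.map' (fun g => g * BS.t m n) (fun g h hgh => by
    rw [QuotientGroup.leftRel_apply] at hgh ⊢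
    obtain ⟨j, hj⟩ := Subgroup.mem_zpowers_iff.1 hgh
    refine Subgroup.mem_zpowers_iff.2 ⟨m * j, ?_⟩
    have h1 : BS.a m n ^ m = (BS.t m n)⁻¹ * BS.a m n ^ n * (BS.t m n)⁻¹⁻¹ := by
      rw [inv_inv, mul_assoc, ← BS.t_mul_a_pow, inv_mul_cancel_left]
    rw [zpow_mul, zpow_natCast, h1, conj_zpow, hj]
    group) e

variable (m n)

/-- The gluing data of `T_{m,n}`. -/
noncomputable def TGluing : CellGluing where
  Cell := TCell m n
  att
    | _, .vertex v => fun _ => vertexPoint (.vertex v)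
    | _, .edge e => edgeAtt (.vertex (source e)) (.vertex (target e))
  dim_lt := by
    rintro _ (_ | _) x hx
    · simp [sphere_eq_empty_of_subsingleton] at hx
    · exact edgeAtt_dim _ _ _
  finite := by
    rintro _ (_ | _)
    · simp [sphere_eq_empty_of_subsingleton]
    · exact edgeAtt_finite _ _ _
  continuous := by
    rintro _ (_ | _) A hA
    · simp [sphere_eq_empty_of_subsingleton]
    · exact edgeAtt_closed _ _ _

/-- The tree `T_{m,n}`, as a `1`-dimensional CW complex: the Bass-Serre tree of `BS(m, n)`, in which
every vertex has `m` incoming and `n` outgoing edges. -/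
abbrev T : Type := (TGluing m n).Space

variable {m n}

/-- The edge of `T_{m,n}` below the vertical edge from `g` to `g t_i`, and below the face to the
right of it. -/
def stripEdge (g : BS m n) (i : ZMod (m.gcd n)) :
    BS m n ⧸ Subgroup.zpowers (BS.a m n ^ n) :=
  ((g * (BS.a m n ^ (n / m.gcd n * i.val))⁻¹ : BS m n) :
    BS m n ⧸ Subgroup.zpowers (BS.a m n ^ n))

variable (m n)

/-- The projection `X_{m,n} → T_{m,n}`: it collapses the horizontal direction. -/
def proj : X m n → T m n
  | ⟨_, .vertex g, _, _⟩ => vertexPoint (Cell := TCell m n) (.vertex g)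
  | ⟨_, .horizontal g, _, _⟩ => vertexPoint (Cell := TCell m n) (.vertex g)
  | ⟨_, .vertical g i, x, hx⟩ => (⟨1, .edge (stripEdge g i), x, hx⟩ : CellPoint (TCell m n))
  | ⟨_, .face g i, x, hx⟩ => (⟨1, .edge (stripEdge g i), fun _ => x 1, by
      rw [mem_ball_zero_iff, pi_norm_lt_iff one_pos] at hx ⊢
      exact fun _ => hx 1⟩ : CellPoint (TCell m n))

variable {m n}

theorem source_stripEdge (g : BS m n) (i : ZMod (m.gcd n)) (j : ℤ) :
    source (stripEdge g i) = ((g * BS.a m n ^ j : BS m n) : BS m n ⧸ _) := by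
  refine Quotient.sound' ?_
  rw [QuotientGroup.leftRel_apply]
  refine Subgroup.mem_zpowers_iff.2 ⟨(n / m.gcd n * i.val : ℕ) + j, ?_⟩
  rw [zpow_add, zpow_natCast]
  simp only [id_eq]
  group

theorem target_stripEdge (g : BS m n) (i : ZMod (m.gcd n)) (j : ℤ) :
    target (stripEdge g i) =
      ((g * BS.tt m n i * BS.a m n ^ j : BS m n) : BS m n ⧸ _) := by
  refine Quotient.sound' ?_
  rw [QuotientGroup.leftRel_apply]
  refine Subgroup.mem_zpowers_iff.2 ⟨(m / m.gcd n * i.val : ℕ) + j, ?_⟩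
  rw [zpow_add, zpow_natCast, BS.tt]
  group

theorem stripEdge_succ (g : BS m n) (i : ZMod (m.gcd n)) :
    stripEdge (g * BS.a m n ^ (n / m.gcd n)) (i + 1) = stripEdge g i := by
  symm
  refine Quotient.sound' ?_
  rw [QuotientGroup.leftRel_apply]
  rcases Nat.eq_zero_or_pos (m.gcd n) with hk | hk
  · simp [hk]
  have : NeZero (m.gcd n) := ⟨hk.ne'⟩
  have hi : ((i.val + 1 : ℕ) : ZMod (m.gcd n)) = i + 1 := by simp
  rcases (Nat.succ_le_of_lt (ZMod.val_lt i)).lt_or_eq with h | h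
  · have hv : (i + 1).val = i.val + 1 := by rw [← hi, ZMod.val_natCast_of_lt h]
    refine Subgroup.mem_zpowers_iff.2 ⟨0, ?_⟩
    rw [hv, mul_add, mul_one, pow_add]
    group
  · have hv : (i + 1).val = 0 := by
      rw [← hi, show i.val + 1 = m.gcd n from h]
      simp
    have hn : n / m.gcd n * i.val + n / m.gcd n = n := by
      rw [← Nat.mul_succ, h]
      exact Nat.div_mul_cancel (Nat.gcd_dvd_right m n)
    refine Subgroup.mem_zpowers_iff.2 ⟨1, ?_⟩
    rw [hv, mul_zero, pow_zero, inv_one, mul_one, zpow_one]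
    have ha : BS.a m n ^ n = BS.a m n ^ (n / m.gcd n * i.val) * BS.a m n ^ (n / m.gcd n) := by
      rw [← pow_add, hn]
    rw [ha]
    group

theorem proj_linePoint (g : BS m n) (r : ℝ) : proj m n (linePoint g r) =
    vertexPoint (Cell := TCell m n) (.vertex ((g : BS m n) : BS m n ⧸ _)) := by
  have h (j : ℤ) : ((g * BS.a m n ^ j : BS m n) : BS m n ⧸ Subgroup.zpowers (BS.a m n)) = g :=
    QuotientGroup.mk_mul_of_mem _ (Subgroup.zpow_mem_zpowers _ _)
  have h' (j : ℤ) : ((g * BS.a m n ^ j * BS.a m n : BS m n) :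
      BS m n ⧸ Subgroup.zpowers (BS.a m n)) = g := by
    rw [QuotientGroup.mk_mul_of_mem _ (Subgroup.mem_zpowers _), h]
  unfold linePoint edgePoint charMap edgeAtt
  split_ifs
  · exact congrArg (fun v => vertexPoint (Cell := TCell m n) (.vertex v)) (h _)
  · exact congrArg (fun v => vertexPoint (Cell := TCell m n) (.vertex v)) (h _)
  · exact congrArg (fun v => vertexPoint (Cell := TCell m n) (.vertex v)) (h' _)

theorem proj_verticalPoint (g : BS m n) (i : ZMod (m.gcd n)) (s : ℝ) :
    proj m n (verticalPoint g i s) =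
      (TGluing m n).map (d := 1) (.edge (stripEdge g i)) (fun _ => s) := by
  have h0 := source_stripEdge g i 0
  have h1 := target_stripEdge g i 0
  rw [zpow_zero, mul_one] at h0 h1
  unfold verticalPoint edgePoint charMap CellGluing.map charMap edgeAtt
  split_ifs with hs hs'
  · rfl
  · refine Eq.trans ?_ (if_pos hs').symm
    rw [h0]
    rfl
  · refine Eq.trans ?_ (if_neg hs').symm
    rw [h1]
    rfl

theorem proj_map_face (g : BS m n) (i : ZMod (m.gcd n)) {x : Fin 2 → ℝ}
    (hx : x ∈ closedBall (0 : Fin 2 → ℝ) 1) :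
    proj m n ((XGluing m n).map (d := 2) (.face g i) x) =
      (TGluing m n).map (d := 1) (.edge (stripEdge g i)) (fun _ => x 1) := by
  rcases (mem_closedBall.1 hx).lt_or_eq with h | h
  · refine (congrArg (proj m n)
      ((XGluing m n).map_of_mem (d := 2) (.face g i) (mem_ball.2 h))).trans ?_
    exact ((TGluing m n).map_of_mem (d := 1) (.edge (stripEdge g i)) _).symm
  · refine (congrArg (proj m n) ((XGluing m n).map_of_notMem (d := 2) (.face g i)
      (CellGluing.notMem_ball_of_mem_sphere (mem_sphere.2 h)))).trans ?_
    change proj m n (faceAtt g i x) = _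
    obtain ⟨-, h | h | h | h⟩ := mem_sphere_two.1 (mem_sphere.2 h)
    · have h0 := source_stripEdge g i 0
      rw [zpow_zero, mul_one] at h0
      rw [faceAtt_bottom _ _ h, proj_linePoint, h, ← h0]
      exact (edgePoint_neg_one (Cell := TCell m n) _ _ _).symm
    · have h1 := target_stripEdge g i 0
      rw [zpow_zero, mul_one] at h1
      rw [faceAtt_top _ _ h, proj_linePoint, h, ← h1]
      exact (edgePoint_one (Cell := TCell m n) _ _ _).symm
    · rw [faceAtt_left _ _ h, proj_verticalPoint]
    · rw [faceAtt_right _ _ h, proj_verticalPoint, stripEdge_succ]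

/-- The projection is continuous. -/
theorem continuous_proj : Continuous (proj m n) := by
  refine continuous_iSup_dom.2 fun d => continuous_iSup_dom.2 fun c =>
    continuous_coinduced_dom.2 ?_
  rcases c with g | g | ⟨g, i⟩ | ⟨g, i⟩
  · exact continuous_of_const fun x y => by rw [Subsingleton.elim x y]
  · refine continuous_of_const fun x y => ?_
    have h (x : Fin 1 → ℝ) : proj m n ((XGluing m n).map (d := 1) (.horizontal g) x) =
        vertexPoint (Cell := TCell m n) (.vertex (g : BS m n ⧸ _)) := by
      unfold CellGluing.map charMap
      split_ifs
      · rfl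
      · change proj m n (edgeAtt _ _ x) = _
        unfold edgeAtt
        split_ifs
        · rfl
        · exact congrArg (fun v => vertexPoint (Cell := TCell m n) (.vertex v))
            (QuotientGroup.mk_mul_of_mem _ (Subgroup.mem_zpowers _))
    exact (h x).trans (h y).symm
  · have h (x : Fin 1 → ℝ) : proj m n ((XGluing m n).map (d := 1) (.vertical g i) x) =
        (TGluing m n).map (d := 1) (.edge (stripEdge g i)) x := by
      have : x = fun _ => x 0 := funext fun j => by rw [Subsingleton.elim j 0]
      rw [this]
      exact proj_verticalPoint g i (x 0)
    exact (((TGluing m n).continuousOn_map _).comp_continuous continuous_subtype_val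
      fun x => x.2).congr fun x => (h x).symm
  · have hc : Continuous (fun (x : closedBall (0 : Fin 2 → ℝ) 1) (_ : Fin 1) => x.1 1) :=
      continuous_pi fun _ => (continuous_apply 1).comp continuous_subtype_val
    refine (((TGluing m n).continuousOn_map (d := 1) (.edge (stripEdge g i))).comp_continuous hc
      fun x => ?_).congr fun x => (proj_map_face g i x.2).symm
    have := x.2
    rw [mem_closedBall_zero_iff, pi_norm_le_iff_of_nonneg zero_le_one] at this ⊢
    exact fun _ => this 1

end BassSerreTree

end BaumslagSolitar

/-! Write `N = n / k` and `M = m / k`, so that a face has `N` horizontal edges at its bottom and `M`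
at its top; `m ≠ n` means `N ≠ M`.

The topology is first reduced to combinatorics. A combinatorial automorphism is determined by its
permutation of the cells, and this permutation preserves incidence, the relation that one cell meets
the closure of another (`incident_act_iff`, `isAut_act`). The projection acts on cells through
`projCell`, and being induced by it is equivariance of `projCell` (`isInducedBy_iff`). As `projCell`
is surjective, uniqueness, multiplicativity and continuity of the induced map are formal. What
remains is that each incidence-preserving permutation `P` descends to an automorphism of the tree,
and that `P = 1` if it descends to the identity.

Descent. Incidence recognizes the types of cells: a vertex is incident only to itself, a face has an
edge in its boundary, and a horizontal edge lies on at least three faces because `N` or `M` exceeds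
1, whereas a vertical edge lies on at most two. So `P` preserves horizontal and vertical edges. The
cells above a vertex of the tree form a line, connected through horizontal edges; those above an
open edge form a strip, connected through the incidence of vertical edges and faces. Hence `P` maps
fibres of `projCell` to fibres (`projCell_congr`). Counting the horizontal edges of a face above
each end of its tree edge distinguishes bottom from top, since `N ≠ M`, so the map of the tree
respects sources and targets (`projCell_corners`, `exists_treeMap`).

Injectivity. If `P` descends to the identity, it shifts each strip by some integer `s`, which moves
vertices by `N * s` on the line below and by `M * s` on the line above (`exists_shift`). Crossing a
strip towards the side with fewer edges strictly decreases the absolute value of a nonzero shift, so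
by descent all vertices are fixed (`apply_vCell_eq`). Since `a` has infinite order, the other cells
are then fixed too (`eq_one`). -/

namespace BaumslagSolitar

open Metric Set

/-! ### Cells, incidence and combinatorial automorphisms of glued complexes -/

namespace CellGluing

variable (G : CellGluing)

/-- The cell containing a point. -/
def cellOf (p : G.Space) : Σ d, G.Cell d := ⟨CellPoint.dim p, CellPoint.cell p⟩

variable {G}

theorem cellOf_map {d : ℕ} (c : G.Cell d) {x : Fin d → ℝ} (h : x ∈ ball (0 : Fin d → ℝ) 1) :
    G.cellOf (G.map c x) = ⟨d, c⟩ := by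
  rw [map_of_mem _ _ h]
  rfl

variable (G)

theorem cellOf_surjective : Function.Surjective G.cellOf := fun ⟨_, c⟩ =>
  ⟨G.map c 0, cellOf_map c (mem_ball_self one_pos)⟩

theorem openCell_eq {d : ℕ} (c : G.Cell d) :
    Topology.CWComplex.openCell (C := (univ : Set G.Space)) d c = G.cellOf ⁻¹' {⟨d, c⟩} := by
  ext p
  constructor
  · rintro ⟨x, hx, rfl⟩
    exact cellOf_map c hx
  · intro hp
    obtain ⟨e, b, y, hy⟩ := p
    obtain ⟨rfl, h2⟩ := Sigma.mk.inj_iff.1 (mem_singleton_iff.1 hp)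
    obtain rfl := eq_of_heq h2
    exact ⟨y, hy, map_of_mem G b hy⟩

theorem mem_openCells_iff {s : Set G.Space} :
    s ∈ openCells G.Space ↔ ∃ c, s = G.cellOf ⁻¹' {c} := by
  constructor
  · rintro ⟨d, c, rfl⟩
    exact ⟨_, G.openCell_eq c⟩
  · rintro ⟨⟨d, c⟩, rfl⟩
    exact ⟨d, c, (G.openCell_eq c).symm⟩

theorem preimage_cellOf_injective : Function.Injective fun c => G.cellOf ⁻¹' {c} := by
  intro c b h
  obtain ⟨p, rfl⟩ := G.cellOf_surjective c
  exact (Set.ext_iff.1 h p).1 rfl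

/-- The open cells of a glued complex are indexed by the gluing data. -/
noncomputable def cellEquiv : (Σ d, G.Cell d) ≃ openCells G.Space :=
  Equiv.ofBijective (fun c => ⟨G.cellOf ⁻¹' {c}, G.mem_openCells_iff.2 ⟨c, rfl⟩⟩)
    ⟨fun _ _ h => G.preimage_cellOf_injective (Subtype.ext_iff.1 h), fun ⟨_, hs⟩ => by
      obtain ⟨c, rfl⟩ := G.mem_openCells_iff.1 hs
      exact ⟨c, rfl⟩⟩

/-- The action of the combinatorial automorphism group on the index set of the cells. -/
noncomputable def act : CombAut G.Space →* Equiv.Perm (Σ d, G.Cell d) :=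
  (G.cellEquiv.symm.permCongrHom.toMonoidHom).comp (CombAut.onCells G.Space)

/-- The combinatorial automorphism group is a quotient by exactly the kernel of the action on cells.
-/
theorem act_injective : Function.Injective G.act :=
  G.cellEquiv.symm.permCongrHom.injective.comp (QuotientGroup.kerLift_injective _)

theorem cellEquiv_act (f : CombAut G.Space) (c : Σ d, G.Cell d) :
    G.cellEquiv (G.act f c) = CombAut.onCells G.Space f (G.cellEquiv c) :=
  G.cellEquiv.apply_symm_apply _

/-- The class of a topological automorphism. -/
noncomputable def toCombAut (f : topAut G.Space) : CombAut G.Space :=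
  QuotientGroup.mk' (cellPerm G.Space).ker f

theorem toCombAut_surjective : Function.Surjective G.toCombAut :=
  QuotientGroup.mk'_surjective _

theorem preimage_act (f : topAut G.Space) (c : Σ d, G.Cell d) :
    G.cellOf ⁻¹' {G.act (G.toCombAut f) c} = f.1 '' (G.cellOf ⁻¹' {c}) :=
  congrArg Subtype.val (G.cellEquiv_act (G.toCombAut f) c)

theorem act_cellOf (f : topAut G.Space) (p : G.Space) :
    G.act (G.toCombAut f) (G.cellOf p) = G.cellOf (f.1 p) :=
  ((Set.ext_iff.1 (G.preimage_act f (G.cellOf p)) (f.1 p)).2 ⟨p, rfl, rfl⟩).symm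

/-- The cell `b` meets the closed cell of `c`. -/
def Incident (b c : Σ d, G.Cell d) : Prop :=
  ∃ x ∈ closedBall (0 : Fin c.1 → ℝ) 1, G.cellOf (G.map c.2 x) = b

variable {G}

theorem Incident.refl (c : Σ d, G.Cell d) : G.Incident c c :=
  ⟨0, mem_closedBall_self zero_le_one, cellOf_map c.2 (mem_ball_self one_pos)⟩

/-- A union of cells that contains the boundary of each of its cells is closed. -/
theorem isClosed_preimage_cellOf {S : Set (Σ d, G.Cell d)}
    (hS : ∀ c ∈ S, ∀ b, G.Incident b c → b ∈ S) : IsClosed (G.cellOf ⁻¹' S) := by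
  rw [isClosed_iff]
  intro d
  induction d using Nat.strong_induction_on with
  | _ d ih =>
    intro c
    -- If the cell lies in `S`, so does everything its closed ball meets, and the preimage is the
    -- whole ball. Otherwise only the sphere can meet `S`, and the gluing condition applies with the
    -- induction hypothesis.
    by_cases hc : (⟨d, c⟩ : Σ d, G.Cell d) ∈ S
    · have : closedBall 0 1 ∩ G.map c ⁻¹' (G.cellOf ⁻¹' S) = closedBall 0 1 :=
        inter_eq_left.2 fun x hx => hS _ hc _ ⟨x, hx, rfl⟩
      rw [this]
      exact isClosed_closedBall
    · convert G.continuous d c (G.cellOf ⁻¹' S) ih using 1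
      ext x
      simp only [mem_inter_iff, mem_preimage]
      constructor
      · rintro ⟨hx, hxS⟩
        have hb : x ∉ ball (0 : Fin d → ℝ) 1 := fun hb => hc (by rwa [cellOf_map c hb] at hxS)
        rw [map_of_notMem _ _ hb] at hxS
        exact ⟨le_antisymm (mem_closedBall.1 hx) (not_lt.1 hb), hxS⟩
      · rintro ⟨hx, hxS⟩
        rw [map_of_notMem _ _ (notMem_ball_of_mem_sphere hx)]
        exact ⟨sphere_subset_closedBall hx, hxS⟩

/-- This makes incidence a topological notion. In a general CW complex the boundary of a cell need
not be a union of cells; transitivity of incidence is what makes the cells incident to `c` a closed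
union, which then contains the closure of `c`. -/
theorem incident_iff_closure (h : ∀ b c d, G.Incident b c → G.Incident c d → G.Incident b d)
    (b c : Σ d, G.Cell d) :
    G.Incident b c ↔ (G.cellOf ⁻¹' {b} ∩ closure (G.cellOf ⁻¹' {c})).Nonempty := by
  constructor
  · rintro ⟨x, hx, hb⟩
    refine ⟨_, hb, ?_⟩
    -- A point of the closed ball is a limit of points of the open ball, and the characteristic map
    -- is continuous up to the boundary.
    rw [← closure_ball (0 : Fin c.1 → ℝ) one_ne_zero] at hx
    have hcont : ContinuousOn (G.map c.2) (closure (ball 0 1)) := by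
      rw [closure_ball (0 : Fin c.1 → ℝ) one_ne_zero]
      exact G.continuousOn_map c.2
    refine closure_mono ?_ (hcont.image_closure (mem_image_of_mem _ hx))
    rintro _ ⟨y, hy, rfl⟩
    exact cellOf_map c.2 hy
  · rintro ⟨p, rfl, hp⟩
    have hcl : IsClosed (G.cellOf ⁻¹' {b | G.Incident b c}) :=
      isClosed_preimage_cellOf fun c' hc' b hb => h _ _ _ hb hc'
    refine closure_minimal ?_ hcl hp
    rintro q rfl
    exact Incident.refl _

/-- Homeomorphisms commute with closures, so this follows from the topological description of
incidence. -/
theorem incident_act_iff (h : ∀ b c d, G.Incident b c → G.Incident c d → G.Incident b d)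
    (f : CombAut G.Space) (b c : Σ d, G.Cell d) :
    G.Incident (G.act f b) (G.act f c) ↔ G.Incident b c := by
  obtain ⟨f, rfl⟩ := G.toCombAut_surjective f
  rw [incident_iff_closure h, incident_iff_closure h, preimage_act, preimage_act,
    ← f.1.image_closure, ← image_inter f.1.injective, image_nonempty]

/-- The map on points induced by a map on cells. -/
def mapPoint (F : ∀ d, G.Cell d → G.Cell d) (p : CellPoint G.Cell) : CellPoint G.Cell :=
  ⟨p.dim, F _ p.cell, p.coord, p.mem⟩

theorem mapPoint_map {F : ∀ d, G.Cell d → G.Cell d}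
    (hF : ∀ d c x, G.att d (F d c) x = mapPoint F (G.att d c x)) {d : ℕ} (c : G.Cell d)
    (x : Fin d → ℝ) : mapPoint F (G.map c x) = G.map (F d c) x := by
  by_cases hx : x ∈ ball (0 : Fin d → ℝ) 1
  · rw [map_of_mem _ _ hx, map_of_mem _ _ hx]
    rfl
  · rw [map_of_notMem _ _ hx, map_of_notMem _ _ hx, hF]

theorem continuous_mapPoint {F : ∀ d, G.Cell d → G.Cell d}
    (hF : ∀ d c x, G.att d (F d c) x = mapPoint F (G.att d c x)) :
    Continuous (X := G.Space) (Y := G.Space) (mapPoint F) := by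
  refine continuous_iSup_dom.2 fun d => continuous_iSup_dom.2 fun c =>
    continuous_coinduced_dom.2 ?_
  exact ((G.continuousOn_map (F d c)).comp_continuous continuous_subtype_val fun x => x.2).congr
    fun x => (mapPoint_map hF c x.1).symm

/-- Permutations of the cells that are compatible with the attaching maps are realized by
combinatorial automorphisms. -/
theorem exists_act_eq {F F' : ∀ d, G.Cell d → G.Cell d}
    (hF : ∀ d c x, G.att d (F d c) x = mapPoint F (G.att d c x))
    (hF' : ∀ d c x, G.att d (F' d c) x = mapPoint F' (G.att d c x))
    (h : ∀ d c, F' d (F d c) = c) (h' : ∀ d c, F d (F' d c) = c) :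
    ∃ f : CombAut G.Space, ∀ d (c : G.Cell d), G.act f ⟨d, c⟩ = ⟨d, F d c⟩ := by
  let f : G.Space ≃ₜ G.Space :=
    { toFun := mapPoint F
      invFun := mapPoint F'
      left_inv := fun ⟨d, c, x, hx⟩ => congrArg (fun c => (⟨d, c, x, hx⟩ : CellPoint G.Cell)) (h d c)
      right_inv := fun ⟨d, c, x, hx⟩ =>
        congrArg (fun c => (⟨d, c, x, hx⟩ : CellPoint G.Cell)) (h' d c)
      continuous_toFun := continuous_mapPoint hF
      continuous_invFun := continuous_mapPoint hF' }
  let Q : (Σ d, G.Cell d) ≃ (Σ d, G.Cell d) :=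
    { toFun := fun c => ⟨c.1, F _ c.2⟩
      invFun := fun c => ⟨c.1, F' _ c.2⟩
      left_inv := fun ⟨d, c⟩ => congrArg (Sigma.mk d) (h d c)
      right_inv := fun ⟨d, c⟩ => congrArg (Sigma.mk d) (h' d c) }
  have hQ (p : G.Space) : G.cellOf (f p) = Q (G.cellOf p) := rfl
  have himg (c : Σ d, G.Cell d) : f '' (G.cellOf ⁻¹' {c}) = G.cellOf ⁻¹' {Q c} := by
    ext p
    constructor
    · rintro ⟨q, rfl, rfl⟩
      rfl
    · intro hp
      obtain ⟨q, rfl⟩ := f.surjective p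
      exact ⟨q, Q.injective hp, rfl⟩
  have hf : f ∈ topAut G.Space := by
    intro s
    rw [mem_openCells_iff, mem_openCells_iff]
    constructor
    · rintro ⟨c, hc⟩
      refine ⟨Q.symm c, f.injective.image_injective ?_⟩
      rw [himg, Q.apply_symm_apply]
      exact hc
    · rintro ⟨c, rfl⟩
      exact ⟨Q c, himg c⟩
  refine ⟨G.toCombAut ⟨f, hf⟩, fun d c => ?_⟩
  obtain ⟨p, hp⟩ := G.cellOf_surjective ⟨d, c⟩
  rw [← hp, act_cellOf]
  exact (hQ p).trans (congrArg Q hp)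

end CellGluing

/-! ### Homomorphisms induced by cellular projections -/

/-- A map between glued complexes that carries cells into cells, as prescribed by `r`, induces `φ`
iff `r` is equivariant. -/
theorem isInducedBy_iff {G H : CellGluing} {p : G.Space → H.Space}
    {r : (Σ d, G.Cell d) → (Σ d, H.Cell d)} (hr : ∀ x, H.cellOf (p x) = r (G.cellOf x))
    (φ : CombAut G.Space →* CombAut H.Space) :
    IsInducedBy p φ ↔ ∀ f c, r (G.act f c) = H.act (φ f) (r c) := by
  -- Open cells are nonempty and pairwise disjoint, so a single point of `σ` decides which cell
  -- contains the image.
  have key (σ : Σ d, G.Cell d) (τ : Σ d, H.Cell d) :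
      MapsTo p (G.cellEquiv σ).1 (H.cellEquiv τ).1 ↔ r σ = τ := by
    constructor
    · intro h
      obtain ⟨x, rfl⟩ := G.cellOf_surjective σ
      exact (hr x).symm.trans (h (show x ∈ (G.cellEquiv (G.cellOf x)).1 from rfl))
    · rintro rfl x rfl
      exact hr x
  constructor
  · intro h f σ
    have := h f (G.cellEquiv σ) (H.cellEquiv (r σ)) ((key _ _).2 rfl)
    rw [← G.cellEquiv_act, ← H.cellEquiv_act] at this
    exact (key _ _).1 this
  · intro h f s t e
    obtain ⟨σ, rfl⟩ := G.cellEquiv.surjective s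
    obtain ⟨τ, rfl⟩ := H.cellEquiv.surjective t
    rw [← G.cellEquiv_act, ← H.cellEquiv_act]
    rw [key] at e ⊢
    rw [h, e]

section Induced

variable {G H : CellGluing} {p : G.Space → H.Space} {r : (Σ d, G.Cell d) → (Σ d, H.Cell d)}

theorem eq_of_act_apply_eq (hs : Function.Surjective r) {h h' : CombAut H.Space}
    (e : ∀ c, H.act h (r c) = H.act h' (r c)) : h = h' := by
  refine H.act_injective (Equiv.ext fun c => ?_)
  obtain ⟨c, rfl⟩ := hs c
  exact e c

/-- An automorphism of the target is determined by its action on the image of `r`, which is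
everything. So the automorphisms chosen for each `f` are unique, and this forces the choice to be
multiplicative. -/
theorem existsUnique_isInducedBy (hr : ∀ x, H.cellOf (p x) = r (G.cellOf x))
    (hs : Function.Surjective r)
    (h : ∀ f : CombAut G.Space, ∃ h : CombAut H.Space, ∀ c, r (G.act f c) = H.act h (r c)) :
    ∃! φ : CombAut G.Space →* CombAut H.Space, IsInducedBy p φ := by
  choose h hh using h
  refine ⟨MonoidHom.mk' h fun f g => eq_of_act_apply_eq hs fun c => ?_,
    (isInducedBy_iff hr _).2 hh, fun φ hφ => MonoidHom.ext fun f =>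
      eq_of_act_apply_eq hs fun c => ?_⟩
  · rw [← hh, map_mul, map_mul, Equiv.Perm.mul_apply, Equiv.Perm.mul_apply, hh, hh]
  · rw [← (isInducedBy_iff hr φ).1 hφ]
    exact hh f c

/-- Lift the cell `σ` to some `c`. Then `φ f` sends `σ` to `τ` iff `f` sends `c` to some cell above
`τ`, so the preimage of a subbasic set is a union of subbasic sets. -/
theorem continuous_of_isInducedBy (hr : ∀ x, H.cellOf (p x) = r (G.cellOf x))
    (hs : Function.Surjective r) {φ : CombAut G.Space →* CombAut H.Space}
    (hφ : IsInducedBy p φ) : Continuous φ := by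
  rw [isInducedBy_iff hr] at hφ
  refine continuous_generateFrom_iff.2 ?_
  rintro _ ⟨σ, τ, rfl⟩
  obtain ⟨σ, rfl⟩ := H.cellEquiv.surjective σ
  obtain ⟨τ, rfl⟩ := H.cellEquiv.surjective τ
  obtain ⟨c, rfl⟩ := hs σ
  have : φ ⁻¹' {f | CombAut.onCells H.Space f (H.cellEquiv (r c)) = H.cellEquiv τ} =
      ⋃ d ∈ {d | r d = τ}, {f : CombAut G.Space |
        CombAut.onCells G.Space f (G.cellEquiv c) = G.cellEquiv d} := by
    ext f
    simp only [Set.mem_preimage, Set.mem_ofPred_eq, Set.mem_iUnion, ← CellGluing.cellEquiv_act,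
      EmbeddingLike.apply_eq_iff_eq, exists_prop]
    rw [← hφ]
    exact ⟨fun h => ⟨_, h, rfl⟩, by rintro ⟨d, h, hd⟩; rwa [hd]⟩
  rw [this]
  exact isOpen_biUnion fun d _ => TopologicalSpace.isOpen_generateFrom_of_mem ⟨_, _, rfl⟩

theorem injective_of_isInducedBy (hr : ∀ x, H.cellOf (p x) = r (G.cellOf x))
    (h : ∀ f, (∀ c, r (G.act f c) = r c) → G.act f = 1)
    {φ : CombAut G.Space →* CombAut H.Space} (hφ : IsInducedBy p φ) : Function.Injective φ := by
  rw [isInducedBy_iff hr] at hφ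
  refine (injective_iff_map_eq_one φ).2 fun f hf => G.act_injective ?_
  rw [map_one]
  refine h f fun c => ?_
  rw [hφ, hf, map_one, Equiv.Perm.one_apply]

end Induced

/-! ### The group: order of `a`, height, cosets of `⟨a⟩` -/

namespace BS

variable {m n : ℕ}

/-- A homomorphism out of `BS(m, n)`. -/
theorem exists_hom {H : Type*} [Group H] (x y : H) (h : y * x ^ m = x ^ n * y) :
    ∃ φ : BS m n →* H, φ (a m n) = x ∧ φ (t m n) = y := by
  have hrel : ∀ r ∈ ({(FreeGroup.of 1 * FreeGroup.of 0 ^ m * (FreeGroup.of 1)⁻¹ *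
      (FreeGroup.of 0 ^ n)⁻¹ : FreeGroup (Fin 2))} : Set (FreeGroup (Fin 2))),
      FreeGroup.lift ![x, y] r = 1 := by
    rintro _ rfl
    simp [h]
  refine ⟨PresentedGroup.toGroup hrel, ?_, ?_⟩
  · exact (PresentedGroup.toGroup.of hrel).trans rfl
  · exact (PresentedGroup.toGroup.of hrel).trans rfl

/-- The generator `a` has infinite order. -/
theorem a_zpow_injective (hm : 0 < m) (hn : 0 < n) :
    Function.Injective fun j : ℤ => a m n ^ j := by
  have hm' : (m : ℚ) ≠ 0 := by exact_mod_cast hm.ne'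
  have hn' : (n : ℚ) ≠ 0 := by exact_mod_cast hn.ne'
  have hpow (N : ℕ) (x : ℚ) : (Equiv.addRight (1 : ℚ) ^ N) x = x + N := by
    induction N generalizing x with
    | zero => simp
    | succ N ih => rw [pow_succ, Equiv.Perm.mul_apply, ih]; simp; ring
  -- The affine action on `ℚ`: `a` acts as `x ↦ x + 1` and `t` as `x ↦ (n / m) x`.
  obtain ⟨φ, hφ, -⟩ := exists_hom (m := m) (n := n) (Equiv.addRight (1 : ℚ))
    (Equiv.mulRight₀ ((n : ℚ) / m) (div_ne_zero hn' hm')) (by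
      ext x
      rw [Equiv.Perm.mul_apply, Equiv.Perm.mul_apply, hpow, hpow]
      change (x + m) * ((n : ℚ) / m) = x * (n / m) + n
      field_simp)
  rw [injective_zpow_iff_not_isOfFinOrder, isOfFinOrder_iff_pow_eq_one]
  rintro ⟨N, hN, h⟩
  have h1 := congrArg φ h
  rw [map_pow, hφ, map_one] at h1
  have h2 := congrArg (fun e : Equiv.Perm ℚ => e 0) h1
  simp only [hpow] at h2
  simp at h2
  omega

/-- Iterates the relation of a face along a strip. It computes the upper end of a shifted vertical
edge: moving the lower end by `N * s` moves the upper one by `M * s`. -/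
theorem tt_mul_zpow (i : ZMod (m.gcd n)) (s : ℤ) :
    tt m n i * a m n ^ (((m / m.gcd n : ℕ) : ℤ) * s) =
      a m n ^ (((n / m.gcd n : ℕ) : ℤ) * s) * tt m n (i + s) := by
  induction s with
  | zero => simp
  | succ s ih =>
    have h := tt_mul m n (i + s)
    rw [mul_add, mul_add, zpow_add, zpow_add, ← mul_assoc, ih, mul_one, mul_one, mul_assoc,
      zpow_natCast (a m n) (m / m.gcd n), zpow_natCast (a m n) (n / m.gcd n), Int.cast_natCast, h]
    push_cast
    rw [mul_assoc, add_assoc]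
  | pred s ih =>
    have h := tt_mul m n (i + (-s - 1 : ℤ))
    have e : i + ((-s - 1 : ℤ) : ZMod (m.gcd n)) + 1 = i + ((-s : ℤ) : ZMod (m.gcd n)) := by
      push_cast; ring
    rw [e] at h
    rw [mul_sub, mul_sub, zpow_sub, zpow_sub, ← mul_assoc, ih, mul_one, mul_one, mul_assoc,
      mul_assoc, zpow_natCast (a m n) (m / m.gcd n), zpow_natCast (a m n) (n / m.gcd n)]
    congr 1
    rw [mul_inv_eq_iff_eq_mul, mul_assoc, h, inv_mul_cancel_left]

/-- The height function sending `a` to `0` and `t` to `1`; it separates the `t_i` from the powers of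
`a`. -/
theorem exists_height : ∃ φ : BS m n →* Multiplicative ℤ, φ (a m n) = 1 ∧
    ∀ i, φ (tt m n i) = Multiplicative.ofAdd 1 := by
  obtain ⟨φ, h1, h2⟩ := exists_hom (m := m) (n := n) (1 : Multiplicative ℤ)
    (Multiplicative.ofAdd 1) (by simp)
  refine ⟨φ, h1, fun i => ?_⟩
  rw [tt, map_mul, map_mul, map_inv, map_pow, map_pow, h1, h2]
  simp

theorem tt_ne_zpow (i : ZMod (m.gcd n)) (j : ℤ) : tt m n i ≠ a m n ^ j := by
  intro h
  obtain ⟨φ, h1, h2⟩ := exists_height (m := m) (n := n)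
  have h3 := congrArg φ h
  rw [h2, map_zpow, h1, one_zpow] at h3
  exact absurd (congrArg Multiplicative.toAdd h3) one_ne_zero

theorem coset_eq_iff {g h : BS m n} :
    (g : BS m n ⧸ Subgroup.zpowers (a m n)) = h ↔ ∃ j : ℤ, h = g * a m n ^ j := by
  rw [QuotientGroup.eq, Subgroup.mem_zpowers_iff]
  exact exists_congr fun j => by rw [eq_inv_mul_iff_mul_eq, eq_comm]

theorem coset_mul_zpow (g : BS m n) (j : ℤ) :
    ((g * a m n ^ j : BS m n) : BS m n ⧸ Subgroup.zpowers (a m n)) = g :=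
  (coset_eq_iff.2 ⟨j, rfl⟩).symm

theorem coset_mul_pow (g : BS m n) (j : ℕ) :
    ((g * a m n ^ j : BS m n) : BS m n ⧸ Subgroup.zpowers (a m n)) = g := by
  rw [← zpow_natCast, coset_mul_zpow]

theorem coset_mul_a (g : BS m n) :
    ((g * a m n : BS m n) : BS m n ⧸ Subgroup.zpowers (a m n)) = g := by
  simp

/-- The tree has no loops: the two ends of a vertical edge lie on different horizontal lines,
because they have different heights. -/
theorem coset_mul_tt_ne (g : BS m n) (i : ZMod (m.gcd n)) :
    ((g * tt m n i : BS m n) : BS m n ⧸ Subgroup.zpowers (a m n)) ≠ g := by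
  intro h
  obtain ⟨j, hj⟩ := coset_eq_iff.1 h.symm
  exact tt_ne_zpow i j (mul_left_cancel hj)

end BS

/-! ### Strips and points on edges -/

variable {m n : ℕ}

/-- A function that agrees on consecutive vertical edges is constant on strips. -/
theorem eq_of_eq_succ {α : Type*} {f : BS m n → ZMod (m.gcd n) → α}
    (hf : ∀ g i, f (g * BS.a m n ^ (n / m.gcd n)) (i + 1) = f g i) (g : BS m n)
    (i : ZMod (m.gcd n)) (s : ℤ) :
    f (g * BS.a m n ^ (((n / m.gcd n : ℕ) : ℤ) * s)) (i + s) = f g i := by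
  induction s with
  | zero => simp
  | succ s ih =>
    have h := hf (g * BS.a m n ^ (((n / m.gcd n : ℕ) : ℤ) * s)) (i + (s : ℤ))
    rw [← ih, ← h, mul_add, zpow_add, mul_one, zpow_natCast _ (n / m.gcd n), mul_assoc]
    push_cast
    rw [add_assoc]
  | pred s ih =>
    have h := hf (g * BS.a m n ^ (((n / m.gcd n : ℕ) : ℤ) * (-s - 1))) (i + (-s - 1 : ℤ))
    have e : i + ((-s - 1 : ℤ) : ZMod (m.gcd n)) + 1 = i + ((-s : ℤ) : ZMod (m.gcd n)) := by
      push_cast; ring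
    rw [← ih, ← h, e, mul_sub, zpow_sub, mul_one, zpow_natCast _ (n / m.gcd n), mul_assoc,
      inv_mul_cancel_right]

/-- The vertical edges above one edge of the tree form a single sequence indexed by `ℤ`, each step
passing to the opposite side of the face to its right. -/
theorem stripEdge_eq_iff (hm : 0 < m) {g g' : BS m n} {i i' : ZMod (m.gcd n)} :
    stripEdge g' i' = stripEdge g i ↔
      ∃ s : ℤ, g' = g * BS.a m n ^ (((n / m.gcd n : ℕ) : ℤ) * s) ∧ i' = i + s := by
  have : NeZero (m.gcd n) := ⟨(Nat.gcd_pos_of_pos_left n hm).ne'⟩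
  constructor
  · intro h
    obtain ⟨j, hj⟩ := Subgroup.mem_zpowers_iff.1 (QuotientGroup.eq.1 h.symm)
    -- One translation by `a ^ n` crosses `k = gcd(m, n)` faces, since `n = N * k`; the difference
    -- of residues accounts for the rest.
    refine ⟨m.gcd n * j + i'.val - i.val, ?_, by simp⟩
    have hn : (n : ℤ) = ((n / m.gcd n : ℕ) : ℤ) * (m.gcd n : ℕ) := by
      exact_mod_cast (Nat.div_mul_cancel (Nat.gcd_dvd_right m n)).symm
    have hg : g' = g * (BS.a m n ^ (n / m.gcd n * i.val))⁻¹ * (BS.a m n ^ n) ^ j *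
        BS.a m n ^ (n / m.gcd n * i'.val) := by
      rw [hj]; group
    rw [hg, ← zpow_natCast _ n, ← zpow_mul, ← zpow_natCast _ (_ * i.val),
      ← zpow_natCast _ (_ * i'.val), ← zpow_neg, mul_assoc, mul_assoc, ← zpow_add, ← zpow_add]
    congr 2
    generalize n / m.gcd n = N at hn ⊢
    push_cast
    linear_combination (j : ℤ) * hn
  · rintro ⟨s, rfl, rfl⟩
    exact eq_of_eq_succ stripEdge_succ g i s

theorem exists_edgePoint_cell_iff {Cell : ℕ → Type} (e : Cell 1) (p q : Cell 0) (b : Σ d, Cell d) :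
    (∃ s ∈ Icc (-1 : ℝ) 1, (⟨_, (edgePoint e p q s).cell⟩ : Σ d, Cell d) = b) ↔
      b = ⟨1, e⟩ ∨ b = ⟨0, p⟩ ∨ b = ⟨0, q⟩ := by
  constructor
  · rintro ⟨s, -, rfl⟩
    exact edgePoint_cell e p q s
  · rintro (rfl | rfl | rfl)
    · refine ⟨0, by norm_num, ?_⟩
      have h : (fun _ => 0 : Fin 1 → ℝ) ∈ ball (0 : Fin 1 → ℝ) 1 := mem_ball_self one_pos
      rw [edgePoint, charMap, dif_pos h]
    · exact ⟨-1, by norm_num, by rw [edgePoint_neg_one]; rfl⟩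
    · exact ⟨1, by norm_num, by rw [edgePoint_one]; rfl⟩

/-! ### Incidence in `X_{m,n}` and the projection on cells -/

section Cells

variable {m n : ℕ}

/-- The vertex `g` among the cells of `X_{m,n}`. -/
def vCell (g : BS m n) : Σ d, XCell m n d := ⟨0, .vertex g⟩

/-- The horizontal edge from `g` to `g a` among the cells of `X_{m,n}`. -/
def hCell (g : BS m n) : Σ d, XCell m n d := ⟨1, .horizontal g⟩

/-- The vertical edge from `g` to `g t_i` among the cells of `X_{m,n}`. -/
def eCell (g : BS m n) (i : ZMod (m.gcd n)) : Σ d, XCell m n d := ⟨1, .vertical g i⟩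

/-- The face with lower left corner `g` and left side `t_i` among the cells of `X_{m,n}`. -/
def fCell (g : BS m n) (i : ZMod (m.gcd n)) : Σ d, XCell m n d := ⟨2, .face g i⟩

@[elab_as_elim]
theorem cell_cases {C : (Σ d, XCell m n d) → Prop} (c : Σ d, XCell m n d)
    (v : ∀ g, C (vCell g)) (h : ∀ g, C (hCell g)) (e : ∀ g i, C (eCell g i))
    (f : ∀ g i, C (fCell g i)) : C c := by
  rcases c with ⟨_, g | g | ⟨g, i⟩ | ⟨g, i⟩⟩
  exacts [v g, h g, e g i, f g i]

@[simp] theorem vCell_inj {g h : BS m n} : vCell g = vCell h ↔ g = h := by simp [vCell]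
@[simp] theorem hCell_inj {g h : BS m n} : hCell g = hCell h ↔ g = h := by simp [hCell]
@[simp] theorem eCell_inj {g h : BS m n} {i j : ZMod (m.gcd n)} :
    eCell g i = eCell h j ↔ g = h ∧ i = j := by simp [eCell]
@[simp] theorem fCell_inj {g h : BS m n} {i j : ZMod (m.gcd n)} :
    fCell g i = fCell h j ↔ g = h ∧ i = j := by simp [fCell]
@[simp] theorem vCell_ne_hCell (g h : BS m n) : vCell g ≠ hCell h := by simp [vCell, hCell]
@[simp] theorem vCell_ne_eCell (g h : BS m n) (i) : vCell g ≠ eCell h i := by simp [vCell, eCell]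
@[simp] theorem vCell_ne_fCell (g h : BS m n) (i) : vCell g ≠ fCell h i := by simp [vCell, fCell]
@[simp] theorem hCell_ne_eCell (g h : BS m n) (i) : hCell g ≠ eCell h i := by simp [hCell, eCell]
@[simp] theorem hCell_ne_fCell (g h : BS m n) (i) : hCell g ≠ fCell h i := by simp [hCell, fCell]
@[simp] theorem eCell_ne_fCell (g h : BS m n) (i j) : eCell g i ≠ fCell h j := by
  simp [eCell, fCell]
@[simp] theorem hCell_ne_vCell (g h : BS m n) : hCell g ≠ vCell h := (vCell_ne_hCell _ _).symm
@[simp] theorem eCell_ne_vCell (g h : BS m n) (i) : eCell g i ≠ vCell h :=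
  (vCell_ne_eCell _ _ _).symm
@[simp] theorem fCell_ne_vCell (g h : BS m n) (i) : fCell g i ≠ vCell h :=
  (vCell_ne_fCell _ _ _).symm
@[simp] theorem eCell_ne_hCell (g h : BS m n) (i) : eCell g i ≠ hCell h :=
  (hCell_ne_eCell _ _ _).symm
@[simp] theorem fCell_ne_hCell (g h : BS m n) (i) : fCell g i ≠ hCell h :=
  (hCell_ne_fCell _ _ _).symm
@[simp] theorem fCell_ne_eCell (g h : BS m n) (i j) : fCell g i ≠ eCell h j :=
  (eCell_ne_fCell _ _ _ _).symm

/-- Incidence of cells of `X_{m,n}`: the cell `b` meets the closed cell `c`. -/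
def Inc (b c : Σ d, XCell m n d) : Prop := (XGluing m n).Incident b c

theorem inc_refl (c : Σ d, XCell m n d) : Inc c c := CellGluing.Incident.refl (G := XGluing m n) c

theorem inc_vCell_iff (b : Σ d, XCell m n d) (g : BS m n) : Inc b (vCell g) ↔ b = vCell g := by
  constructor
  · rintro ⟨x, -, rfl⟩
    refine CellGluing.cellOf_map (G := XGluing m n) (d := 0) (.vertex g) ?_
    rw [show x = 0 from Subsingleton.elim (α := Fin 0 → ℝ) x 0]
    exact mem_ball_self one_pos
  · rintro rfl
    exact inc_refl _

theorem inc_edge_iff (b : Σ d, XCell m n d) (c : XCell m n 1) (p q : XCell m n 0)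
    (h : XAtt 1 c = edgeAtt p q) : Inc b ⟨1, c⟩ ↔ b = ⟨1, c⟩ ∨ b = ⟨0, p⟩ ∨ b = ⟨0, q⟩ := by
  rw [← exists_edgePoint_cell_iff]
  have key (x : Fin 1 → ℝ) : (XGluing m n).map (d := 1) c x = edgePoint c p q (x 0) := by
    have : x = fun _ => x 0 := funext fun j => by rw [Subsingleton.elim j 0]
    rw [edgePoint, ← this, ← h]
    rfl
  constructor
  · rintro ⟨x, hx, rfl⟩
    rw [mem_closedBall_zero_iff, pi_norm_le_iff_of_nonneg zero_le_one] at hx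
    refine ⟨x 0, abs_le.1 (hx 0), ?_⟩
    dsimp only
    rw [key]
    rfl
  · rintro ⟨s, hs, rfl⟩
    refine ⟨fun _ => s, ?_, ?_⟩
    · rw [mem_closedBall_zero_iff, pi_norm_le_iff_of_nonneg zero_le_one]
      exact fun _ => abs_le.2 hs
    · dsimp only
      rw [key]
      rfl

theorem inc_hCell_iff (b : Σ d, XCell m n d) (g : BS m n) :
    Inc b (hCell g) ↔ b = hCell g ∨ b = vCell g ∨ b = vCell (g * BS.a m n) :=
  inc_edge_iff b _ _ _ rfl

theorem inc_eCell_iff (b : Σ d, XCell m n d) (g : BS m n) (i : ZMod (m.gcd n)) :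
    Inc b (eCell g i) ↔ b = eCell g i ∨ b = vCell g ∨ b = vCell (g * BS.tt m n i) :=
  inc_edge_iff b _ _ _ rfl

theorem exists_linePoint_cell_iff (g : BS m n) {N : ℕ} (hN : 0 < N) (b : Σ d, XCell m n d) :
    (∃ r ∈ Icc (0 : ℝ) N, (⟨_, (linePoint g r).cell⟩ : Σ d, XCell m n d) = b) ↔
      ∃ j < N, Inc b (hCell (g * BS.a m n ^ j)) := by
  simp only [inc_hCell_iff]
  constructor
  · rintro ⟨r, hr, rfl⟩
    have h : ∃ j < N, r ∈ Icc (j : ℝ) (j + 1) := by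
      rcases hr.2.lt_or_eq with h | h
      · exact ⟨⌊r⌋₊, (Nat.floor_lt hr.1).2 h, Nat.floor_le hr.1, (Nat.lt_floor_add_one r).le⟩
      -- The right end `r = N` belongs to the last edge of the segment, whose index is `N - 1`.
      · refine ⟨N - 1, by omega, ?_⟩
        have : ((N - 1 : ℕ) : ℝ) = N - 1 := by push_cast [Nat.one_le_iff_ne_zero.2 hN.ne']; rfl
        rw [this, h]
        constructor <;> linarith
    obtain ⟨j, hj, hr⟩ := h
    refine ⟨j, hj, ?_⟩
    rw [linePoint_eq g j hr]
    exact edgePoint_cell _ _ _ _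
  · rintro ⟨j, hj, h⟩
    obtain ⟨s, hs, hb⟩ := (exists_edgePoint_cell_iff _ _ _ _).2 h
    have hr : j + (s + 1) / 2 ∈ Icc (j : ℝ) (j + 1) :=
      ⟨by linarith [hs.1], by linarith [hs.2]⟩
    have hjN : (j : ℝ) + 1 ≤ N := by exact_mod_cast hj
    refine ⟨j + (s + 1) / 2, ⟨j.cast_nonneg.trans hr.1, hr.2.trans hjN⟩, ?_⟩
    have e : 2 * (j + (s + 1) / 2 - j) - 1 = s := by ring
    rw [linePoint_eq g j hr, e]
    exact hb

/-- Inverts the parametrization of the horizontal sides of the square used by `faceAtt`. -/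
theorem exists_sphere_line {N : ℕ} (hN : 0 < N) {r : ℝ} (hr : r ∈ Icc (0 : ℝ) N) :
    2 * r / N - 1 ∈ Icc (-1 : ℝ) 1 ∧ (N : ℝ) * ((2 * r / N - 1 + 1) / 2) = r := by
  have hN' : (0 : ℝ) < N := by exact_mod_cast hN
  refine ⟨⟨?_, ?_⟩, by field_simp; ring⟩
  · have := div_nonneg (mul_nonneg zero_le_two hr.1) hN'.le
    linarith
  · have : 2 * r / N ≤ 2 := (div_le_iff₀ hN').2 (by linarith [hr.2])
    linarith

/-- The boundary is read off side by side from the attaching map. Positivity of `m` and `n` ensures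
that the bottom and the top consist of at least one edge each, so that all corners are accounted for
by edges. -/
theorem inc_fCell_iff (hm : 0 < m) (hn : 0 < n) (b : Σ d, XCell m n d) (g : BS m n)
    (i : ZMod (m.gcd n)) : Inc b (fCell g i) ↔ b = fCell g i ∨
      (∃ j < n / m.gcd n, Inc b (hCell (g * BS.a m n ^ j))) ∨
      (∃ j < m / m.gcd n, Inc b (hCell (g * BS.tt m n i * BS.a m n ^ j))) ∨
      Inc b (eCell g i) ∨ Inc b (eCell (g * BS.a m n ^ (n / m.gcd n)) (i + 1)) := by
  have hN : 0 < n / m.gcd n := Nat.div_gcd_pos_of_pos_right m hn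
  have hM : 0 < m / m.gcd n := Nat.div_gcd_pos_of_pos_left n hm
  rw [← exists_linePoint_cell_iff g hN, ← exists_linePoint_cell_iff (g * BS.tt m n i) hM,
    inc_eCell_iff, inc_eCell_iff]
  have hv (g : BS m n) (i) : b = eCell g i ∨ b = vCell g ∨ b = vCell (g * BS.tt m n i) ↔
      ∃ s ∈ Icc (-1 : ℝ) 1, (⟨_, (verticalPoint g i s).cell⟩ : Σ d, XCell m n d) = b :=
    (exists_edgePoint_cell_iff _ _ _ _).symm
  rw [hv, hv]
  -- The attaching map takes values in dimension below 2, so the image of the sphere consists of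
  -- exactly the incident cells other than the face itself.
  have hs : (∃ x ∈ sphere (0 : Fin 2 → ℝ) 1,
      (⟨_, (faceAtt g i x).cell⟩ : Σ d, XCell m n d) = b) ↔ Inc b (fCell g i) ∧ b ≠ fCell g i := by
    constructor
    · rintro ⟨x, hx, rfl⟩
      refine ⟨⟨x, sphere_subset_closedBall hx, ?_⟩, ?_⟩
      · have := (XGluing m n).map_of_notMem (d := 2) (.face g i)
          (CellGluing.notMem_ball_of_mem_sphere hx)
        exact congrArg (XGluing m n).cellOf this
      · intro h
        have h1 : (faceAtt g i x).dim = 2 := congrArg Sigma.fst h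
        exact absurd (faceAtt_dim g i x) (by omega)
    · rintro ⟨⟨x, hx, rfl⟩, h⟩
      have hb : x ∉ ball (0 : Fin 2 → ℝ) 1 := fun hb =>
        h (CellGluing.cellOf_map (G := XGluing m n) (d := 2) (.face g i) hb)
      refine ⟨x, le_antisymm (mem_closedBall.1 hx) (not_lt.1 hb), ?_⟩
      exact (congrArg (XGluing m n).cellOf
        ((XGluing m n).map_of_notMem (d := 2) (.face g i) hb)).symm
  have hb : Inc b (fCell g i) ↔ b = fCell g i ∨ Inc b (fCell g i) ∧ b ≠ fCell g i := by
    constructor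
    · tauto
    · rintro (rfl | h)
      exacts [inc_refl _, h.1]
  rw [hb, ← hs]
  refine or_congr_right ?_
  constructor
  · rintro ⟨x, hx, rfl⟩
    obtain ⟨⟨h0, h1⟩, h | h | h | h⟩ := mem_sphere_two.1 hx
    · exact Or.inl ⟨_, mul_half_mem h0, by rw [faceAtt_bottom _ _ h]⟩
    · exact Or.inr (Or.inl ⟨_, mul_half_mem h0, by rw [faceAtt_top _ _ h]⟩)
    · exact Or.inr (Or.inr (Or.inl ⟨_, h1, by rw [faceAtt_left _ _ h]⟩))
    · exact Or.inr (Or.inr (Or.inr ⟨_, h1, by rw [faceAtt_right _ _ h]⟩))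
  · have h1 : (1 : ℝ) ∈ Icc (-1 : ℝ) 1 := by norm_num
    have h2 : (-1 : ℝ) ∈ Icc (-1 : ℝ) 1 := by norm_num
    rintro (⟨r, hr, rfl⟩ | ⟨r, hr, rfl⟩ | ⟨s, h3, rfl⟩ | ⟨s, h3, rfl⟩)
    · obtain ⟨h3, h4⟩ := exists_sphere_line hN hr
      refine ⟨![2 * r / (n / m.gcd n : ℕ) - 1, -1], mem_sphere_two.2 ⟨⟨h3, h2⟩, Or.inl rfl⟩, ?_⟩
      rw [faceAtt_bottom g i (x := ![_, -1]) rfl, Matrix.cons_val_zero, h4]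
    · obtain ⟨h3, h4⟩ := exists_sphere_line hM hr
      refine ⟨![2 * r / (m / m.gcd n : ℕ) - 1, 1],
        mem_sphere_two.2 ⟨⟨h3, h1⟩, Or.inr (Or.inl rfl)⟩, ?_⟩
      rw [faceAtt_top g i (x := ![_, 1]) rfl, Matrix.cons_val_zero, h4]
    · refine ⟨![-1, s], mem_sphere_two.2 ⟨⟨h2, h3⟩, Or.inr (Or.inr (Or.inl rfl))⟩, ?_⟩
      rw [faceAtt_left g i (x := ![-1, s]) rfl]
      rfl
    · refine ⟨![1, s], mem_sphere_two.2 ⟨⟨h1, h3⟩, Or.inr (Or.inr (Or.inr rfl))⟩, ?_⟩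
      rw [faceAtt_right g i (x := ![1, s]) rfl]
      rfl

/-- Closed cells of this complex are unions of open cells, because faces are attached along whole
edges. This is the hypothesis needed to describe incidence by closures. -/
theorem inc_trans (hm : 0 < m) (hn : 0 < n) (b c d : Σ d, XCell m n d) (hbc : Inc b c)
    (hcd : Inc c d) : Inc b d := by
  have hv {g : BS m n} (h : c = vCell g) : b = c := by
    subst h
    exact (inc_vCell_iff _ _).1 hbc
  have hh {g : BS m n} (h : Inc c (hCell g)) : Inc b (hCell g) := by
    rcases (inc_hCell_iff _ _).1 h with rfl | h' | h'
    · exact hbc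
    · rwa [hv h']
    · rwa [hv h']
  have he {g : BS m n} {i} (h : Inc c (eCell g i)) : Inc b (eCell g i) := by
    rcases (inc_eCell_iff _ _ _).1 h with rfl | h' | h'
    · exact hbc
    · rwa [hv h']
    · rwa [hv h']
  cases d using cell_cases with
  | v g =>
    have h := (inc_vCell_iff _ _).1 hcd
    rwa [hv h]
  | h g => exact hh hcd
  | e g i => exact he hcd
  | f g i =>
    rcases (inc_fCell_iff hm hn _ _ _).1 hcd with rfl | ⟨j, hj, h⟩ | ⟨j, hj, h⟩ | h | h
    · exact hbc
    · exact (inc_fCell_iff hm hn _ _ _).2 (Or.inr (Or.inl ⟨j, hj, hh h⟩))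
    · exact (inc_fCell_iff hm hn _ _ _).2 (Or.inr (Or.inr (Or.inl ⟨j, hj, hh h⟩)))
    · exact (inc_fCell_iff hm hn _ _ _).2 (Or.inr (Or.inr (Or.inr (Or.inl (he h)))))
    · exact (inc_fCell_iff hm hn _ _ _).2 (Or.inr (Or.inr (Or.inr (Or.inr (he h)))))

/-- The cell of the tree below a cell of `X_{m,n}`. -/
def projCell : (Σ d, XCell m n d) → (Σ d, TCell m n d)
  | ⟨_, .vertex g⟩ => ⟨0, .vertex g⟩
  | ⟨_, .horizontal g⟩ => ⟨0, .vertex g⟩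
  | ⟨_, .vertical g i⟩ => ⟨1, .edge (stripEdge g i)⟩
  | ⟨_, .face g i⟩ => ⟨1, .edge (stripEdge g i)⟩

theorem cellOf_proj (p : X m n) :
    (TGluing m n).cellOf (proj m n p) = projCell ((XGluing m n).cellOf p) := by
  rcases p with ⟨_, g | g | ⟨g, i⟩ | ⟨g, i⟩, x, hx⟩ <;> rfl

theorem projCell_vCell (g : BS m n) : projCell (vCell g) = ⟨0, .vertex g⟩ := rfl
theorem projCell_hCell (g : BS m n) : projCell (hCell g) = ⟨0, .vertex g⟩ := rfl
theorem projCell_eCell (g : BS m n) (i) : projCell (eCell g i) = ⟨1, .edge (stripEdge g i)⟩ := rfl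
theorem projCell_fCell (g : BS m n) (i) : projCell (fCell g i) = ⟨1, .edge (stripEdge g i)⟩ := rfl

theorem projCell_surjective : Function.Surjective (projCell (m := m) (n := n)) := by
  rintro ⟨_, v | e⟩
  · obtain ⟨g, rfl⟩ := QuotientGroup.mk_surjective v
    exact ⟨vCell g, rfl⟩
  · obtain ⟨g, rfl⟩ := QuotientGroup.mk_surjective e
    refine ⟨eCell (g * BS.a m n ^ (n / m.gcd n * (0 : ZMod (m.gcd n)).val)) 0, ?_⟩
    rw [projCell_eCell, stripEdge, mul_inv_cancel_right]

end Cells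

/-! ### Recognizing the types of cells by incidence -/

section Automorphisms

variable {m n : ℕ}

theorem inc_hCell_fCell_iff (hm : 0 < m) (hn : 0 < n) (h g : BS m n) (i : ZMod (m.gcd n)) :
    Inc (hCell h) (fCell g i) ↔ (∃ j < n / m.gcd n, h = g * BS.a m n ^ j) ∨
      ∃ j < m / m.gcd n, h = g * BS.tt m n i * BS.a m n ^ j := by
  simp [inc_fCell_iff hm hn, inc_hCell_iff, inc_eCell_iff]

theorem inc_eCell_fCell_iff (hm : 0 < m) (hn : 0 < n) (h g : BS m n) (l i : ZMod (m.gcd n)) :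
    Inc (eCell h l) (fCell g i) ↔
      h = g ∧ l = i ∨ h = g * BS.a m n ^ (n / m.gcd n) ∧ l = i + 1 := by
  simp [inc_fCell_iff hm hn, inc_hCell_iff, inc_eCell_iff]

/-- Characterization of the vertices by incidence. -/
def IsVertex (c : Σ d, XCell m n d) : Prop := ∀ b, Inc b c → b = c

/-- Characterization of the faces by incidence. -/
def IsFace (c : Σ d, XCell m n d) : Prop := ∃ b, Inc b c ∧ b ≠ c ∧ ¬ IsVertex b

/-- Characterization of the horizontal edges by incidence: they lie on at least three faces. -/
def IsHorizontal (c : Σ d, XCell m n d) : Prop :=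
  ¬ IsVertex c ∧ ∃ x y z, (Inc c x ∧ x ≠ c) ∧ (Inc c y ∧ y ≠ c) ∧ (Inc c z ∧ z ≠ c) ∧
    x ≠ y ∧ x ≠ z ∧ y ≠ z

theorem isVertex_vCell (g : BS m n) : IsVertex (vCell g) := fun _ h => (inc_vCell_iff _ _).1 h

theorem not_isVertex_hCell (g : BS m n) : ¬ IsVertex (hCell g) := fun h =>
  vCell_ne_hCell g g (h _ ((inc_hCell_iff _ _).2 (Or.inr (Or.inl rfl))))

theorem not_isVertex_eCell (g : BS m n) (i) : ¬ IsVertex (eCell g i) := fun h =>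
  vCell_ne_eCell g g i (h _ ((inc_eCell_iff _ _ _).2 (Or.inr (Or.inl rfl))))

theorem not_isFace_hCell (g : BS m n) : ¬ IsFace (hCell g) := by
  rintro ⟨b, hb, hne, hv⟩
  rcases (inc_hCell_iff _ _).1 hb with rfl | rfl | rfl
  exacts [hne rfl, hv (isVertex_vCell _), hv (isVertex_vCell _)]

theorem not_isFace_eCell (g : BS m n) (i) : ¬ IsFace (eCell g i) := by
  rintro ⟨b, hb, hne, hv⟩
  rcases (inc_eCell_iff _ _ _).1 hb with rfl | rfl | rfl
  exacts [hne rfl, hv (isVertex_vCell _), hv (isVertex_vCell _)]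

theorem not_isFace_vCell (g : BS m n) : ¬ IsFace (vCell g) := by
  rintro ⟨b, hb, hne, -⟩
  exact hne ((inc_vCell_iff _ _).1 hb)

theorem isFace_fCell (hm : 0 < m) (hn : 0 < n) (g : BS m n) (i) : IsFace (fCell g i) :=
  ⟨eCell g i, (inc_eCell_fCell_iff hm hn _ _ _ _).2 (Or.inl ⟨rfl, rfl⟩), eCell_ne_fCell _ _ _ _,
    not_isVertex_eCell _ _⟩

theorem not_isVertex_fCell (hm : 0 < m) (hn : 0 < n) (g : BS m n) (i) :
    ¬ IsVertex (fCell g i) := fun h =>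
  eCell_ne_fCell g g i i (h _ ((inc_eCell_fCell_iff hm hn _ _ _ _).2 (Or.inl ⟨rfl, rfl⟩)))

/-- A strip is a linear sequence of faces, so only the faces directly to the right and to the left
contain a given vertical edge. -/
theorem exists_fCell_of_inc_eCell (hm : 0 < m) (hn : 0 < n) {g : BS m n} {i}
    {c : Σ d, XCell m n d} (h : Inc (eCell g i) c) : c = eCell g i ∨ c = fCell g i ∨
      c = fCell (g * (BS.a m n ^ (n / m.gcd n))⁻¹) (i - 1) := by
  cases c using cell_cases with
  | v g => simp [inc_vCell_iff] at h
  | h g => simp [inc_hCell_iff] at h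
  | e g i =>
    rw [inc_eCell_iff] at h
    simp at h
    simp [h]
  | f g i =>
    rw [inc_eCell_fCell_iff hm hn] at h
    rcases h with ⟨rfl, rfl⟩ | ⟨rfl, rfl⟩
    · simp
    · simp

theorem not_isHorizontal_eCell (hm : 0 < m) (hn : 0 < n) (g : BS m n) (i) :
    ¬ IsHorizontal (eCell g i) := by
  rintro ⟨-, x, y, z, ⟨hx, hx'⟩, ⟨hy, hy'⟩, ⟨hz, hz'⟩, hxy, hxz, hyz⟩
  have h1 := exists_fCell_of_inc_eCell hm hn hx
  have h2 := exists_fCell_of_inc_eCell hm hn hy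
  have h3 := exists_fCell_of_inc_eCell hm hn hz
  grind

theorem not_isHorizontal_fCell (hm : 0 < m) (hn : 0 < n) (g : BS m n) (i) :
    ¬ IsHorizontal (fCell g i) := by
  rintro ⟨-, x, y, z, ⟨hx, hx'⟩, -⟩
  cases x using cell_cases with
  | v g => simp [inc_vCell_iff] at hx
  | h g => simp [inc_hCell_iff] at hx
  | e g i => simp [inc_eCell_iff] at hx
  | f g i =>
    rw [inc_fCell_iff hm hn] at hx
    simp [inc_hCell_iff, inc_eCell_iff] at hx
    exact hx' (by simp [hx])

theorem div_gcd_ne (hmn : m ≠ n) : n / m.gcd n ≠ m / m.gcd n := by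
  intro h
  have h1 := Nat.div_mul_cancel (Nat.gcd_dvd_left m n)
  have h2 := Nat.div_mul_cancel (Nat.gcd_dvd_right m n)
  rw [h] at h2
  exact hmn (h1.symm.trans h2)

/-- One face above and one face below the edge always exist. A third comes from sliding one of them
by `a⁻¹`, which keeps the edge on its boundary if that side has length at least 2. The remaining
case `N = M = 1` is excluded by `m ≠ n`. -/
theorem isHorizontal_hCell (hm : 0 < m) (hn : 0 < n) (hmn : m ≠ n) (g : BS m n) :
    IsHorizontal (hCell g) := by
  have hN : 0 < n / m.gcd n := Nat.div_gcd_pos_of_pos_right m hn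
  have hM : 0 < m / m.gcd n := Nat.div_gcd_pos_of_pos_left n hm
  have hNM := div_gcd_ne hmn
  have ha : BS.a m n ≠ 1 := fun h => by
    have := BS.a_zpow_injective hm hn (a₁ := 1) (a₂ := 0) (by simp [h])
    omega
  have ht (j : ℤ) : BS.tt m n 0 ≠ BS.a m n ^ j := BS.tt_ne_zpow 0 j
  have h1 : Inc (hCell g) (fCell g 0) :=
    (inc_hCell_fCell_iff hm hn _ _ _).2 (Or.inl ⟨0, hN, by simp⟩)
  have h2 : Inc (hCell g) (fCell (g * (BS.tt m n 0)⁻¹) 0) :=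
    (inc_hCell_fCell_iff hm hn _ _ _).2 (Or.inr ⟨0, hM, by simp⟩)
  have h12 : fCell g 0 ≠ fCell (g * (BS.tt m n 0)⁻¹) 0 := by
    have := ht 0
    simpa using this
  refine ⟨not_isVertex_hCell g, ?_⟩
  -- If the bottom side is long, slide the upper face; otherwise the top side is long, and the lower
  -- face is slid. Distinctness uses `a ≠ 1` and that `t_0` is not a power of `a`.
  rcases Nat.lt_or_ge 1 (n / m.gcd n) with h | h
  · refine ⟨_, _, fCell (g * (BS.a m n)⁻¹) 0, ⟨h1, by simp⟩, ⟨h2, by simp⟩,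
      ⟨(inc_hCell_fCell_iff hm hn _ _ _).2 (Or.inl ⟨1, h, by simp⟩), by simp⟩, h12, ?_, ?_⟩
    · simpa using ha
    · have := ht 1
      simpa using this
  · have h' : 1 < m / m.gcd n := by omega
    refine ⟨_, _, fCell (g * (BS.a m n)⁻¹ * (BS.tt m n 0)⁻¹) 0, ⟨h1, by simp⟩, ⟨h2, by simp⟩,
      ⟨(inc_hCell_fCell_iff hm hn _ _ _).2 (Or.inr ⟨1, h', by simp⟩), by simp⟩, h12, ?_, ?_⟩
    · have := ht (-1)
      rw [Ne, fCell_inj, mul_assoc, left_eq_mul, mul_eq_one_iff_eq_inv, inv_inv]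
      intro h
      exact this (by rw [← h.1]; simp)
    · simpa using ha

/-! ### Incidence-preserving permutations preserve the types of cells -/

/-- Permutations of the cells preserving incidence. -/
def IsAut (P : Equiv.Perm (Σ d, XCell m n d)) : Prop := ∀ b c, Inc (P b) (P c) ↔ Inc b c

namespace IsAut

variable {P : Equiv.Perm (Σ d, XCell m n d)}

theorem inv (hP : IsAut P) : IsAut P⁻¹ := fun b c => by
  rw [← hP]
  simp

theorem isVertex (hP : IsAut P) {c : Σ d, XCell m n d} (h : IsVertex c) : IsVertex (P c) := by
  intro b hb
  obtain ⟨b, rfl⟩ := P.surjective b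
  rw [h b ((hP _ _).1 hb)]

theorem not_isVertex (hP : IsAut P) {c : Σ d, XCell m n d} (h : ¬ IsVertex c) :
    ¬ IsVertex (P c) := fun h' => h (by simpa using hP.inv.isVertex h')

theorem isFace (hP : IsAut P) {c : Σ d, XCell m n d} (h : IsFace c) : IsFace (P c) := by
  obtain ⟨b, hb, hne, hv⟩ := h
  exact ⟨P b, (hP _ _).2 hb, P.injective.ne hne, hP.not_isVertex hv⟩

theorem isHorizontal (hP : IsAut P) {c : Σ d, XCell m n d} (h : IsHorizontal c) :
    IsHorizontal (P c) := by
  obtain ⟨hv, x, y, z, ⟨hx, hx'⟩, ⟨hy, hy'⟩, ⟨hz, hz'⟩, hxy, hxz, hyz⟩ := h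
  exact ⟨hP.not_isVertex hv, P x, P y, P z, ⟨(hP _ _).2 hx, P.injective.ne hx'⟩,
    ⟨(hP _ _).2 hy, P.injective.ne hy'⟩, ⟨(hP _ _).2 hz, P.injective.ne hz'⟩,
    P.injective.ne hxy, P.injective.ne hxz, P.injective.ne hyz⟩

theorem isHorizontal_iff (hP : IsAut P) {c : Σ d, XCell m n d} :
    IsHorizontal (P c) ↔ IsHorizontal c :=
  ⟨fun h => by simpa using hP.inv.isHorizontal h, hP.isHorizontal⟩

theorem exists_vCell (hm : 0 < m) (hn : 0 < n) (hP : IsAut P) (g : BS m n) :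
    ∃ g', P (vCell g) = vCell g' := by
  have h := hP.isVertex (isVertex_vCell g)
  generalize P (vCell g) = c at h
  cases c using cell_cases with
  | v g => exact ⟨g, rfl⟩
  | h g => exact absurd h (not_isVertex_hCell g)
  | e g i => exact absurd h (not_isVertex_eCell g i)
  | f g i => exact absurd h (not_isVertex_fCell hm hn g i)

theorem exists_fCell (hm : 0 < m) (hn : 0 < n) (hP : IsAut P) (g : BS m n) (i) :
    ∃ g' i', P (fCell g i) = fCell g' i' := by
  have h := hP.isFace (isFace_fCell hm hn g i)
  generalize P (fCell g i) = c at h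
  cases c using cell_cases with
  | v g => exact absurd h (not_isFace_vCell g)
  | h g => exact absurd h (not_isFace_hCell g)
  | e g i => exact absurd h (not_isFace_eCell g i)
  | f g i => exact ⟨g, i, rfl⟩

theorem exists_hCell (hm : 0 < m) (hn : 0 < n) (hmn : m ≠ n) (hP : IsAut P) (g : BS m n) :
    ∃ g', P (hCell g) = hCell g' := by
  have h := hP.isHorizontal (isHorizontal_hCell hm hn hmn g)
  generalize P (hCell g) = c at h
  cases c using cell_cases with
  | v g => exact absurd (isVertex_vCell g) h.1
  | h g => exact ⟨g, rfl⟩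
  | e g i => exact absurd h (not_isHorizontal_eCell hm hn g i)
  | f g i => exact absurd h (not_isHorizontal_fCell hm hn g i)

/-- By elimination: the inverse permutation preserves each of the three other types, so none of them
can be the type of the image. -/
theorem exists_eCell (hm : 0 < m) (hn : 0 < n) (hmn : m ≠ n) (hP : IsAut P) (g : BS m n) (i) :
    ∃ g' i', P (eCell g i) = eCell g' i' := by
  have h : ∀ c, P (eCell g i) = c → P⁻¹ c = eCell g i := by
    rintro _ rfl
    simp
  cases hc : P (eCell g i) using cell_cases with
  | v g' =>
    obtain ⟨x, hx⟩ := hP.inv.exists_vCell hm hn g'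
    have := h _ hc
    simp [hx] at this
  | h g' =>
    obtain ⟨x, hx⟩ := hP.inv.exists_hCell hm hn hmn g'
    have := h _ hc
    simp [hx] at this
  | e g' i' => exact ⟨g', i', rfl⟩
  | f g' i' =>
    obtain ⟨x, y, hx⟩ := hP.inv.exists_fCell hm hn g' i'
    have := h _ hc
    simp [hx] at this

end IsAut

/-! ### Descent to the cells of the tree; bottom and top of faces -/

theorem projCell_eq_of_inc_hCell {b : Σ d, XCell m n d} {g : BS m n} (h : Inc b (hCell g)) :
    projCell b = projCell (hCell g) := by
  rcases (inc_hCell_iff _ _).1 h with rfl | rfl | rfl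
  · rfl
  · rfl
  · rw [projCell_vCell, projCell_hCell, BS.coset_mul_a]

theorem projCell_eq_of_inc_fCell (hm : 0 < m) (hn : 0 < n) {h g : BS m n} {l i : ZMod (m.gcd n)}
    (hi : Inc (eCell h l) (fCell g i)) : projCell (eCell h l) = projCell (fCell g i) := by
  rcases (inc_eCell_fCell_iff hm hn _ _ _ _).1 hi with ⟨rfl, rfl⟩ | ⟨rfl, rfl⟩
  · rfl
  · rw [projCell_eCell, projCell_fCell, stripEdge_succ]

/-- The horizontal edges of the closed cell `c` that lie above `v`. -/
def horizontalsOver (c : Σ d, XCell m n d) (v : Σ d, TCell m n d) : Set (Σ d, XCell m n d) :=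
  {b | IsHorizontal b ∧ Inc b c ∧ projCell b = v}

theorem ncard_image_hCell (hm : 0 < m) (hn : 0 < n) (g : BS m n) (N : ℕ) :
    ((fun j : ℕ => hCell (g * BS.a m n ^ j)) '' Iio N).ncard = N := by
  rw [ncard_image_of_injective]
  · simp [← Finset.coe_Iio, ncard_coe_finset]
  · intro i j h
    have h1 : BS.a m n ^ (i : ℤ) = BS.a m n ^ (j : ℤ) := by simpa using h
    exact_mod_cast BS.a_zpow_injective hm hn h1

/-- The horizontal edges of a face lie above the two distinct ends of its tree edge, with `N` above
the source and `M` above the target. These numbers make the orientation visible to incidence. -/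
theorem horizontalsOver_fCell (hm : 0 < m) (hn : 0 < n) (hmn : m ≠ n) (g : BS m n) (i)
    (v : Σ d, TCell m n d) (h : (horizontalsOver (fCell g i) v).Nonempty) :
    (v = projCell (vCell g) ∧ (horizontalsOver (fCell g i) v).ncard = n / m.gcd n) ∨
    (v = projCell (vCell (g * BS.tt m n i)) ∧
      (horizontalsOver (fCell g i) v).ncard = m / m.gcd n) := by
  have hne := BS.coset_mul_tt_ne g i
  have key (b) (hb : b ∈ horizontalsOver (fCell g i) v) :
      (v = projCell (vCell g) ∧ ∃ j < n / m.gcd n, b = hCell (g * BS.a m n ^ j)) ∨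
      (v = projCell (vCell (g * BS.tt m n i)) ∧
        ∃ j < m / m.gcd n, b = hCell (g * BS.tt m n i * BS.a m n ^ j)) := by
    obtain ⟨hb, hinc, rfl⟩ := hb
    cases b using cell_cases with
    | v x => exact absurd (isVertex_vCell x) hb.1
    | h x =>
      rcases (inc_hCell_fCell_iff hm hn _ _ _).1 hinc with ⟨j, hj, rfl⟩ | ⟨j, hj, rfl⟩
      · exact Or.inl ⟨by rw [projCell_hCell, projCell_vCell, BS.coset_mul_pow], j, hj, rfl⟩
      · exact Or.inr ⟨by rw [projCell_hCell, projCell_vCell, BS.coset_mul_pow], j, hj, rfl⟩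
    | e x i => exact absurd hb (not_isHorizontal_eCell hm hn x i)
    | f x i => exact absurd hb (not_isHorizontal_fCell hm hn x i)
  have hne' : projCell (vCell g) ≠ projCell (vCell (g * BS.tt m n i)) := by
    intro h
    rw [projCell_vCell, projCell_vCell] at h
    simp only [Sigma.mk.injEq, heq_eq_eq, true_and, TCell.vertex.injEq] at h
    exact hne h.symm
  obtain ⟨b, hb⟩ := h
  rcases key b hb with ⟨hv, -⟩ | ⟨hv, -⟩
  · refine Or.inl ⟨hv, ?_⟩
    rw [← ncard_image_hCell hm hn g (n / m.gcd n)]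
    congr 1
    ext b
    constructor
    · intro hb
      rcases key b hb with ⟨-, j, hj, rfl⟩ | ⟨h, -⟩
      · exact ⟨j, hj, rfl⟩
      · exact absurd (hv.symm.trans h) hne'
    · rintro ⟨j, hj, rfl⟩
      refine ⟨isHorizontal_hCell hm hn hmn _,
        (inc_hCell_fCell_iff hm hn _ _ _).2 (Or.inl ⟨j, hj, rfl⟩), ?_⟩
      rw [hv, projCell_hCell, projCell_vCell, BS.coset_mul_pow]
  · refine Or.inr ⟨hv, ?_⟩
    rw [← ncard_image_hCell hm hn (g * BS.tt m n i) (m / m.gcd n)]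
    congr 1
    ext b
    constructor
    · intro hb
      rcases key b hb with ⟨h, -⟩ | ⟨-, j, hj, rfl⟩
      · exact absurd (h.symm.trans hv) hne'
      · exact ⟨j, hj, rfl⟩
    · rintro ⟨j, hj, rfl⟩
      refine ⟨isHorizontal_hCell hm hn hmn _,
        (inc_hCell_fCell_iff hm hn _ _ _).2 (Or.inr ⟨j, hj, rfl⟩), ?_⟩
      rw [hv, projCell_hCell, projCell_vCell, BS.coset_mul_pow]

namespace IsAut

variable {P : Equiv.Perm (Σ d, XCell m n d)}

theorem projCell_eq_of_inc_hCell (hm : 0 < m) (hn : 0 < n) (hmn : m ≠ n) (hP : IsAut P)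
    {b : Σ d, XCell m n d} {g : BS m n} (h : Inc b (hCell g)) :
    projCell (P b) = projCell (P (hCell g)) := by
  obtain ⟨g', hg'⟩ := hP.exists_hCell hm hn hmn g
  have := (hP _ _).2 h
  rw [hg'] at this ⊢
  exact BaumslagSolitar.projCell_eq_of_inc_hCell this

theorem projCell_eq_of_inc_fCell (hm : 0 < m) (hn : 0 < n) (hmn : m ≠ n) (hP : IsAut P)
    {h g : BS m n} {l i : ZMod (m.gcd n)} (hi : Inc (eCell h l) (fCell g i)) :
    projCell (P (eCell h l)) = projCell (P (fCell g i)) := by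
  obtain ⟨g', i', hg'⟩ := hP.exists_fCell hm hn g i
  obtain ⟨h', l', hh'⟩ := hP.exists_eCell hm hn hmn h l
  have := (hP _ _).2 hi
  rw [hg', hh'] at this ⊢
  exact BaumslagSolitar.projCell_eq_of_inc_fCell hm hn this

theorem projCell_vCell_mul (hm : 0 < m) (hn : 0 < n) (hmn : m ≠ n) (hP : IsAut P) (g : BS m n) :
    projCell (P (vCell (g * BS.a m n))) = projCell (P (vCell g)) := by
  have h1 := hP.projCell_eq_of_inc_hCell hm hn hmn (b := vCell (g * BS.a m n)) (g := g)
    ((inc_hCell_iff _ _).2 (by simp))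
  have h2 := hP.projCell_eq_of_inc_hCell hm hn hmn (b := vCell g) (g := g)
    ((inc_hCell_iff _ _).2 (by simp))
  rw [h1, h2]

theorem projCell_vCell_zpow (hm : 0 < m) (hn : 0 < n) (hmn : m ≠ n) (hP : IsAut P) (g : BS m n)
    (j : ℤ) : projCell (P (vCell (g * BS.a m n ^ j))) = projCell (P (vCell g)) := by
  induction j with
  | zero => simp
  | succ j ih => rw [zpow_add_one, ← mul_assoc, hP.projCell_vCell_mul hm hn hmn, ih]
  | pred j ih =>
    rw [← ih, ← hP.projCell_vCell_mul hm hn hmn (g * _), mul_assoc, ← zpow_add_one,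
      sub_add_cancel]

theorem projCell_eCell_succ (hm : 0 < m) (hn : 0 < n) (hmn : m ≠ n) (hP : IsAut P) (g : BS m n)
    (i) : projCell (P (eCell (g * BS.a m n ^ (n / m.gcd n)) (i + 1))) =
      projCell (P (eCell g i)) := by
  rw [hP.projCell_eq_of_inc_fCell hm hn hmn (g := g) (i := i)
      ((inc_eCell_fCell_iff hm hn _ _ _ _).2 (Or.inr ⟨rfl, rfl⟩)),
    hP.projCell_eq_of_inc_fCell hm hn hmn (g := g) (i := i)
      ((inc_eCell_fCell_iff hm hn _ _ _ _).2 (Or.inl ⟨rfl, rfl⟩))]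

theorem projCell_eCell_zpow (hm : 0 < m) (hn : 0 < n) (hmn : m ≠ n) (hP : IsAut P) (g : BS m n)
    (i) (s : ℤ) : projCell (P (eCell (g * BS.a m n ^ (((n / m.gcd n : ℕ) : ℤ) * s)) (i + s))) =
      projCell (P (eCell g i)) :=
  eq_of_eq_succ (f := fun g i => projCell (P (eCell g i))) (hP.projCell_eCell_succ hm hn hmn) g i s

/-- An automorphism descends to the cells of the tree. -/
theorem projCell_congr (hm : 0 < m) (hn : 0 < n) (hmn : m ≠ n) (hP : IsAut P)
    {c d : Σ d, XCell m n d} (h : projCell c = projCell d) :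
    projCell (P c) = projCell (P d) := by
  have hv {g g' : BS m n} (h : projCell (vCell g) = projCell (vCell g')) :
      projCell (P (vCell g)) = projCell (P (vCell g')) := by
    rw [projCell_vCell, projCell_vCell] at h
    simp only [Sigma.mk.injEq, heq_eq_eq, true_and, TCell.vertex.injEq] at h
    obtain ⟨j, rfl⟩ := BS.coset_eq_iff.1 h
    rw [hP.projCell_vCell_zpow hm hn hmn]
  have he {g g' : BS m n} {i i'} (h : projCell (eCell g i) = projCell (eCell g' i')) :
      projCell (P (eCell g i)) = projCell (P (eCell g' i')) := by
    rw [projCell_eCell, projCell_eCell] at h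
    simp only [Sigma.mk.injEq, heq_eq_eq, true_and, TCell.edge.injEq] at h
    obtain ⟨s, rfl, rfl⟩ := (stripEdge_eq_iff hm).1 h
    rw [hP.projCell_eCell_zpow hm hn hmn]
  -- Each cell may be replaced by a vertex or a vertical edge in the same fibre, without changing
  -- the fibre of its image: a horizontal edge by its initial vertex, a face by its left side.
  have hc (c : Σ d, XCell m n d) :
      (∃ g, projCell c = projCell (vCell g) ∧ projCell (P c) = projCell (P (vCell g))) ∨
      (∃ g i, projCell c = projCell (eCell g i) ∧
        projCell (P c) = projCell (P (eCell g i))) := by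
    cases c using cell_cases with
    | v g => exact Or.inl ⟨g, rfl, rfl⟩
    | h g =>
      exact Or.inl ⟨g, rfl,
        (hP.projCell_eq_of_inc_hCell hm hn hmn ((inc_hCell_iff _ _).2 (by simp))).symm⟩
    | e g i => exact Or.inr ⟨g, i, rfl, rfl⟩
    | f g i =>
      exact Or.inr ⟨g, i, rfl, (hP.projCell_eq_of_inc_fCell hm hn hmn
        ((inc_eCell_fCell_iff hm hn _ _ _ _).2 (Or.inl ⟨rfl, rfl⟩))).symm⟩
  have hve {g g' : BS m n} {i} : projCell (vCell g) ≠ projCell (eCell g' i) := by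
    rw [projCell_vCell, projCell_eCell]
    simp
  rcases hc c with ⟨g, h1, h2⟩ | ⟨g, i, h1, h2⟩ <;>
    rcases hc d with ⟨g', h3, h4⟩ | ⟨g', i', h3, h4⟩ <;> rw [h1, h3] at h <;> rw [h2, h4]
  · exact hv h
  · exact absurd h hve
  · exact absurd h.symm hve
  · exact he h

theorem projCell_congr_iff (hm : 0 < m) (hn : 0 < n) (hmn : m ≠ n) (hP : IsAut P)
    {c d : Σ d, XCell m n d} : projCell (P c) = projCell (P d) ↔ projCell c = projCell d :=
  ⟨fun h => by simpa using hP.inv.projCell_congr hm hn hmn h, hP.projCell_congr hm hn hmn⟩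

/-- All three defining conditions are invariant under `P`, so the numbers of horizontal edges of a
face above its two ends are carried along. -/
theorem image_horizontalsOver (hm : 0 < m) (hn : 0 < n) (hmn : m ≠ n) (hP : IsAut P)
    (c d : Σ d, XCell m n d) :
    P '' horizontalsOver c (projCell d) = horizontalsOver (P c) (projCell (P d)) := by
  ext b
  obtain ⟨b, rfl⟩ := P.surjective b
  rw [P.injective.mem_set_image]
  exact and_congr hP.isHorizontal_iff.symm
    (and_congr (hP b c).symm (hP.projCell_congr_iff hm hn hmn).symm)

/-- An automorphism preserves bottom and top of each face. -/
theorem projCell_corners (hm : 0 < m) (hn : 0 < n) (hmn : m ≠ n) (hP : IsAut P)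
    {g g' : BS m n} {i i'} (h : P (fCell g i) = fCell g' i') :
    projCell (P (vCell g)) = projCell (vCell g') ∧
      projCell (P (vCell (g * BS.tt m n i))) = projCell (vCell (g' * BS.tt m n i')) := by
  have hN : 0 < n / m.gcd n := Nat.div_gcd_pos_of_pos_right m hn
  have hM : 0 < m / m.gcd n := Nat.div_gcd_pos_of_pos_left n hm
  have hNM := div_gcd_ne hmn
  have hne := BS.coset_mul_tt_ne g i
  have hne' : projCell (vCell g) ≠ projCell (vCell (g * BS.tt m n i)) := by
    intro h
    rw [projCell_vCell, projCell_vCell] at h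
    simp only [Sigma.mk.injEq, heq_eq_eq, true_and, TCell.vertex.injEq] at h
    exact hne h.symm
  have hcard (d : Σ d, XCell m n d) : (horizontalsOver (fCell g' i') (projCell (P d))).ncard =
      (horizontalsOver (fCell g i) (projCell d)).ncard := by
    rw [← h, ← hP.image_horizontalsOver hm hn hmn, ncard_image_of_injective _ P.injective]
  have h1 : (hCell g) ∈ horizontalsOver (fCell g i) (projCell (vCell g)) :=
    ⟨isHorizontal_hCell hm hn hmn g,
      (inc_hCell_fCell_iff hm hn _ _ _).2 (Or.inl ⟨0, hN, by simp⟩), rfl⟩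
  have h2 : (hCell (g * BS.tt m n i)) ∈
      horizontalsOver (fCell g i) (projCell (vCell (g * BS.tt m n i))) :=
    ⟨isHorizontal_hCell hm hn hmn _,
      (inc_hCell_fCell_iff hm hn _ _ _).2 (Or.inr ⟨0, hM, by simp⟩), rfl⟩
  have h3 := mem_image_of_mem P h1
  have h4 := mem_image_of_mem P h2
  rw [hP.image_horizontalsOver hm hn hmn, h] at h3 h4
  have c1 := hcard (vCell g)
  have c2 := hcard (vCell (g * BS.tt m n i))
  constructor
  -- If the bottom went to the top of the image face, the same set would have both `N` and `M`
  -- elements. The second half excludes the opposite exchange in the same way.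
  · rcases horizontalsOver_fCell hm hn hmn _ _ _ ⟨_, h3⟩ with ⟨h5, -⟩ | ⟨-, h6⟩
    · exact h5
    · rcases horizontalsOver_fCell hm hn hmn _ _ _ ⟨_, h1⟩ with ⟨-, h8⟩ | ⟨h7, -⟩
      · omega
      · exact absurd h7 hne'
  · rcases horizontalsOver_fCell hm hn hmn _ _ _ ⟨_, h4⟩ with ⟨-, h6⟩ | ⟨h5, -⟩
    · rcases horizontalsOver_fCell hm hn hmn _ _ _ ⟨_, h2⟩ with ⟨h7, -⟩ | ⟨-, h8⟩
      · exact absurd h7.symm hne'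
      · omega
    · exact h5

end IsAut

end Automorphisms

/-! ### The induced automorphism of the tree and the triviality of the kernel -/

section

variable {m n : ℕ}

theorem mapPoint_edgeAtt (F : ∀ d, TCell m n d → TCell m n d) (p q : TCell m n 0)
    (x : Fin 1 → ℝ) : edgeAtt (F 0 p) (F 0 q) x =
      CellGluing.mapPoint (G := TGluing m n) F (edgeAtt p q x) := by
  unfold edgeAtt
  split_ifs <;> rfl

theorem exists_stripEdge_eq (e : BS m n ⧸ Subgroup.zpowers (BS.a m n ^ n)) :
    ∃ g i, stripEdge g i = e := by
  obtain ⟨c, hc⟩ := projCell_surjective (⟨1, .edge e⟩ : Σ d, TCell m n d)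
  cases c using cell_cases with
  | v g => simp [projCell_vCell] at hc
  | h g => simp [projCell_hCell] at hc
  | e g i => exact ⟨g, i, by simpa [projCell_eCell] using hc⟩
  | f g i => exact ⟨g, i, by simpa [projCell_fCell] using hc⟩

namespace IsAut

variable {P : Equiv.Perm (Σ d, XCell m n d)}

theorem exists_projCell_eq (hm : 0 < m) (hn : 0 < n) (hmn : m ≠ n) (hP : IsAut P) (d : ℕ)
    (c : TCell m n d) : ∃ c' : TCell m n d, ∀ σ, projCell σ = ⟨d, c⟩ → projCell (P σ) = ⟨d, c'⟩ := by
  rcases c with v | e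
  · obtain ⟨g, rfl⟩ := QuotientGroup.mk_surjective v
    obtain ⟨g', hg'⟩ := hP.exists_vCell hm hn g
    exact ⟨.vertex g', fun σ h => by
      rw [hP.projCell_congr hm hn hmn (h.trans (projCell_vCell g).symm), hg', projCell_vCell]⟩
  · obtain ⟨g, i, rfl⟩ := exists_stripEdge_eq e
    obtain ⟨g', i', hg'⟩ := hP.exists_fCell hm hn g i
    exact ⟨.edge (stripEdge g' i'), fun σ h => by
      rw [hP.projCell_congr hm hn hmn (h.trans (projCell_fCell g i).symm), hg', projCell_fCell]⟩

/-- The map of the tree induced by an automorphism. -/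
theorem exists_treeMap (hm : 0 < m) (hn : 0 < n) (hmn : m ≠ n) (hP : IsAut P) :
    ∃ F : ∀ d, TCell m n d → TCell m n d,
      (∀ σ d c, projCell σ = ⟨d, c⟩ → projCell (P σ) = ⟨d, F d c⟩) ∧
      ∀ d c x, (TGluing m n).att d (F d c) x =
        CellGluing.mapPoint (G := TGluing m n) F ((TGluing m n).att d c x) := by
  choose F hF using hP.exists_projCell_eq hm hn hmn
  refine ⟨F, fun σ d c => hF d c σ, ?_⟩
  rintro _ (v | e) x
  -- The image is again a vertex, whose attaching map is constant; destructing it lets the attaching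
  -- map reduce.
  · generalize hw : F 0 (.vertex v) = w
    cases w
    exact (congrArg (vertexPoint (Cell := TCell m n)) hw).symm
  · obtain ⟨g, i, rfl⟩ := exists_stripEdge_eq e
    obtain ⟨g', i', hg'⟩ := hP.exists_fCell hm hn g i
    -- Compatibility with the attaching map of an edge amounts to preservation of source and target,
    -- which are the images of the two left corners of a face above it.
    obtain ⟨h1, h2⟩ := hP.projCell_corners hm hn hmn hg'
    have e1 := hF 1 (.edge (stripEdge g i)) (fCell g i) rfl
    rw [hg', projCell_fCell] at e1
    rw [hF 0 (.vertex g) (vCell g) rfl, projCell_vCell] at h1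
    rw [hF 0 (.vertex (g * BS.tt m n i : BS m n)) (vCell _) rfl, projCell_vCell] at h2
    simp only [Sigma.mk.injEq, heq_eq_eq, true_and] at e1 h1 h2
    have hs (g : BS m n) (i) : source (stripEdge g i) = g := by
      simpa using source_stripEdge g i 0
    have ht (g : BS m n) (i) : target (stripEdge g i) = (g * BS.tt m n i : BS m n) := by
      simpa using target_stripEdge g i 0
    rw [← e1]
    refine Eq.trans ?_ (mapPoint_edgeAtt F _ _ x)
    rw [hs, ht, h1, h2, ← hs g' i', ← ht g' i']
    rfl

/-- If an automorphism induces the identity on the cells of the tree, then it shifts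
vertical edges within their strips. -/
theorem exists_shift (hm : 0 < m) (hn : 0 < n) (hmn : m ≠ n) (hP : IsAut P)
    (h : ∀ c, projCell (P c) = projCell c) (g : BS m n) (i : ZMod (m.gcd n)) : ∃ s : ℤ,
      P (eCell g i) = eCell (g * BS.a m n ^ (((n / m.gcd n : ℕ) : ℤ) * s)) (i + s) ∧
      P (vCell g) = vCell (g * BS.a m n ^ (((n / m.gcd n : ℕ) : ℤ) * s)) ∧
      P (vCell (g * BS.tt m n i)) =
        vCell (g * BS.tt m n i * BS.a m n ^ (((m / m.gcd n : ℕ) : ℤ) * s)) := by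
  obtain ⟨g', i', hg'⟩ := hP.exists_eCell hm hn hmn g i
  have he := h (eCell g i)
  rw [hg', projCell_eCell, projCell_eCell] at he
  simp only [Sigma.mk.injEq, heq_eq_eq, true_and, TCell.edge.injEq] at he
  -- The image lies in the same strip, hence is a translate of the edge along that strip.
  obtain ⟨s, rfl, rfl⟩ := (stripEdge_eq_iff hm).1 he
  have key (x : BS m n) : ∃ x', P (vCell x) = vCell x' ∧
      (x' : BS m n ⧸ Subgroup.zpowers (BS.a m n)) = x := by
    obtain ⟨x', hx'⟩ := hP.exists_vCell hm hn x
    have := h (vCell x)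
    rw [hx', projCell_vCell, projCell_vCell] at this
    simp only [Sigma.mk.injEq, heq_eq_eq, true_and, TCell.vertex.injEq] at this
    exact ⟨x', hx', this⟩
  obtain ⟨x, hx, hx'⟩ := key g
  obtain ⟨y, hy, hy'⟩ := key (g * BS.tt m n i)
  have h1 := (hP _ _).2 ((inc_eCell_iff _ g i).2 (Or.inr (Or.inl rfl)))
  have h2 := (hP _ _).2 ((inc_eCell_iff _ g i).2 (Or.inr (Or.inr rfl)))
  rw [hg', inc_eCell_iff] at h1 h2
  rw [hx] at h1
  rw [hy] at h2
  simp only [vCell_ne_eCell, vCell_inj, false_or] at h1 h2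
  have ht := BS.tt_mul_zpow i s
  rw [mul_assoc, ← ht, ← mul_assoc] at h1 h2
  have hne := BS.coset_mul_tt_ne g i
  -- Each end goes to an end of the image edge, and it stays on its own horizontal line. The two
  -- ends lie on different lines, so lower goes to lower and upper to upper.
  refine ⟨s, hg', ?_, ?_⟩
  · rcases h1 with rfl | rfl
    · exact hx
    · rw [BS.coset_mul_zpow] at hx'
      exact absurd hx' hne
  · rcases h2 with rfl | rfl
    · rw [BS.coset_mul_zpow] at hy'
      exact absurd hy'.symm hne
    · exact hy

/-- If an automorphism induces the identity on the cells of the tree, then it is trivial on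
vertices. -/
theorem apply_vCell_eq (hm : 0 < m) (hn : 0 < n) (hmn : m ≠ n) (hP : IsAut P)
    (h : ∀ c, projCell (P c) = projCell c) (g : BS m n) : P (vCell g) = vCell g := by
  have hN : 0 < n / m.gcd n := Nat.div_gcd_pos_of_pos_right m hn
  have hM : 0 < m / m.gcd n := Nat.div_gcd_pos_of_pos_left n hm
  have hNM := div_gcd_ne hmn
  have hshift := hP.exists_shift hm hn hmn h
  generalize n / m.gcd n = N at *
  generalize m / m.gcd n = M at *
  have hinj := BS.a_zpow_injective hm hn
  -- Descent on the absolute value of the displacement `j` of a vertex along its line.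
  suffices H : ∀ (l : ℕ) (g : BS m n) (j : ℤ), j.natAbs = l →
      P (vCell g) = vCell (g * BS.a m n ^ j) → j = 0 by
    obtain ⟨s, -, hs, -⟩ := hshift g 0
    have := H _ g _ rfl hs
    rw [hs, this, zpow_zero, mul_one]
  intro l
  induction l using Nat.strong_induction_on with
  | _ l ih =>
    rintro g j rfl hj
    by_contra hj0
    rcases hNM.lt_or_gt with hlt | hlt
    -- For `N < M`, look at a strip below `g`: here `j = M * s`, and the vertex at its lower side is
    -- displaced by the smaller amount `N * s`.
    · obtain ⟨s, -, h2, h1⟩ := hshift (g * (BS.tt m n 0)⁻¹) 0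
      rw [inv_mul_cancel_right] at h1
      rw [hj, vCell_inj, mul_right_inj] at h1
      have hjs : j = M * s := hinj h1
      subst hjs
      have hs : s ≠ 0 := by rintro rfl; simp at hj0
      have hlt' : ((N : ℤ) * s).natAbs < ((M : ℤ) * s).natAbs := by
        rw [Int.natAbs_mul, Int.natAbs_mul, Int.natAbs_natCast, Int.natAbs_natCast]
        exact Nat.mul_lt_mul_of_pos_right hlt (Int.natAbs_pos.2 hs)
      have := ih _ hlt' _ _ rfl h2
      rcases mul_eq_zero.1 this with h | h
      · omega
      · exact hs h
    -- For `M < N`, look at a strip above `g`: here `j = N * s`, and the vertex at its upper side is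
    -- displaced by `M * s`.
    · obtain ⟨s, -, h1, h2⟩ := hshift g 0
      rw [hj, vCell_inj, mul_right_inj] at h1
      have hjs : j = N * s := hinj h1
      subst hjs
      have hs : s ≠ 0 := by rintro rfl; simp at hj0
      have hlt' : ((M : ℤ) * s).natAbs < ((N : ℤ) * s).natAbs := by
        rw [Int.natAbs_mul, Int.natAbs_mul, Int.natAbs_natCast, Int.natAbs_natCast]
        exact Nat.mul_lt_mul_of_pos_right hlt (Int.natAbs_pos.2 hs)
      have := ih _ hlt' _ _ rfl h2
      rcases mul_eq_zero.1 this with h | h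
      · omega
      · exact hs h

/-- An automorphism is determined by the induced map on the cells of the tree. -/
theorem eq_one (hm : 0 < m) (hn : 0 < n) (hmn : m ≠ n) (hP : IsAut P)
    (h : ∀ c, projCell (P c) = projCell c) : P = 1 := by
  have hN : 0 < n / m.gcd n := Nat.div_gcd_pos_of_pos_right m hn
  have hinj := BS.a_zpow_injective hm hn
  have hv := hP.apply_vCell_eq hm hn hmn h
  have hpow {g : BS m n} {j : ℤ} (hj : g = g * BS.a m n ^ j) : j = 0 :=
    hinj (by simpa using hj)
  have he (g : BS m n) (i) : P (eCell g i) = eCell g i := by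
    obtain ⟨s, h1, h2, -⟩ := hP.exists_shift hm hn hmn h g i
    rw [hv, vCell_inj] at h2
    -- The shift of a strip is visible on its lower vertices, which are fixed.
    have hs : s = 0 := by
      rcases mul_eq_zero.1 (hpow h2) with h | h
      · omega
      · exact h
    simpa [hs] using h1
  refine Equiv.ext fun c => ?_
  rw [Equiv.Perm.one_apply]
  cases c using cell_cases with
  | v g => exact hv g
  | h g =>
    obtain ⟨g', hg'⟩ := hP.exists_hCell hm hn hmn g
    have h1 := (hP _ _).2 ((inc_hCell_iff _ g).2 (Or.inr (Or.inl rfl)))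
    have h2 := (hP _ _).2 ((inc_hCell_iff _ g).2 (Or.inr (Or.inr rfl)))
    rw [hv, hg', inc_hCell_iff] at h1 h2
    simp only [vCell_ne_hCell, vCell_inj, false_or] at h1 h2
    rw [hg', hCell_inj]
    rcases h1 with h1 | rfl
    · exact h1.symm
    -- The remaining possibility is that the edge is reversed; that would give `a ^ 2 = 1`.
    rcases h2 with h2 | h2
    · have := hpow (g := g') (j := 2) (by rw [zpow_two, ← mul_assoc, h2])
      omega
    · exact (mul_right_cancel h2).symm
  | e g i => exact he g i
  | f g i =>
    obtain ⟨g', i', hg'⟩ := hP.exists_fCell hm hn g i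
    have h1 := (hP _ _).2 ((inc_eCell_fCell_iff hm hn g g i i).2 (Or.inl ⟨rfl, rfl⟩))
    have h2 := (hP _ _).2 ((inc_eCell_fCell_iff hm hn _ g _ i).2 (Or.inr ⟨rfl, rfl⟩))
    rw [he, hg', inc_eCell_fCell_iff hm hn] at h1 h2
    rw [hg', fCell_inj]
    rcases h1 with ⟨rfl, rfl⟩ | ⟨rfl, rfl⟩
    · exact ⟨rfl, rfl⟩
    -- Otherwise the left side of the face would be the right side of its image. As the right side
    -- is fixed as well, `a ^ (2 * N)` or `a ^ N` would be trivial.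
    exfalso
    rcases h2 with ⟨h2, -⟩ | ⟨h2, -⟩
    · have := hpow (g := g') (j := (n / m.gcd n : ℕ) + (n / m.gcd n : ℕ)) (by
        rw [zpow_add, zpow_natCast, ← mul_assoc, h2])
      omega
    · have := hpow (g := g') (j := (n / m.gcd n : ℕ)) (by
        rw [zpow_natCast, mul_right_cancel h2])
      omega

end IsAut

end

/-! ### From permutations of cells back to automorphisms -/

section

variable {m n : ℕ}

theorem isAut_act (hm : 0 < m) (hn : 0 < n) (f : CombAut (X m n)) :
    IsAut ((XGluing m n).act f) :=
  CellGluing.incident_act_iff (G := XGluing m n) (inc_trans hm hn) f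

/-- Every incidence-preserving permutation of the cells of `X_{m,n}` induces a combinatorial
automorphism of the tree. -/
theorem IsAut.exists_induced (hm : 0 < m) (hn : 0 < n) (hmn : m ≠ n)
    {P : Equiv.Perm (Σ d, XCell m n d)} (hP : IsAut P) :
    ∃ h : CombAut (T m n), ∀ c, projCell (P c) = (TGluing m n).act h (projCell c) := by
  obtain ⟨F, hF, hatt⟩ := hP.exists_treeMap hm hn hmn
  obtain ⟨F', hF', hatt'⟩ := hP.inv.exists_treeMap hm hn hmn
  -- The maps of the tree coming from `P` and `P⁻¹` are mutually inverse, as can be checked after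
  -- lifting a cell to `X_{m,n}`.
  have h1 (d) (c : TCell m n d) : F' d (F d c) = c := by
    obtain ⟨σ, hσ⟩ := projCell_surjective ⟨d, c⟩
    simpa [hσ] using (hF' _ d _ (hF σ d c hσ)).symm
  have h2 (d) (c : TCell m n d) : F d (F' d c) = c := by
    obtain ⟨σ, hσ⟩ := projCell_surjective ⟨d, c⟩
    simpa [hσ] using (hF _ d _ (hF' σ d c hσ)).symm
  obtain ⟨h, hh⟩ := (TGluing m n).exists_act_eq hatt hatt' h1 h2
  exact ⟨h, fun c => (hF c _ _ rfl).trans (hh _ _).symm⟩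

end

end BaumslagSolitar

theorem mainTheorem10 (m n : ℕ) (hm : 0 < m) (hn : 0 < n) (hmn : m ≠ n) :
    (∃! φ : BaumslagSolitar.CombAut (BaumslagSolitar.X m n) →*
        BaumslagSolitar.CombAut (BaumslagSolitar.T m n),
      BaumslagSolitar.IsInducedBy (BaumslagSolitar.proj m n) φ) ∧
    ∀ φ : BaumslagSolitar.CombAut (BaumslagSolitar.X m n) →*
        BaumslagSolitar.CombAut (BaumslagSolitar.T m n),
      BaumslagSolitar.IsInducedBy (BaumslagSolitar.proj m n) φ →
        Continuous φ ∧ Function.Injective φ := by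
  refine ⟨BaumslagSolitar.existsUnique_isInducedBy BaumslagSolitar.cellOf_proj
    BaumslagSolitar.projCell_surjective (fun f =>
      (BaumslagSolitar.isAut_act hm hn f).exists_induced hm hn hmn),
    fun φ hφ => ⟨BaumslagSolitar.continuous_of_isInducedBy BaumslagSolitar.cellOf_proj
      BaumslagSolitar.projCell_surjective hφ,
    BaumslagSolitar.injective_of_isInducedBy BaumslagSolitar.cellOf_proj (fun f =>
      (BaumslagSolitar.isAut_act hm hn f).eq_one hm hn hmn) hφ⟩⟩
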